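/- All rings are commutative with $1$. Let $A$ be an integral domain with quotient field $K$. Call $A$ an \emph{ISP-domain} if every proper nonzero ideal $I$ of $A$ can be written as $I = JQ_1\cdots Q_n$ with $n\ge 1$, $J$ an invertible ideal of $A$ and each $Q_i$ a proper radical ideal of $A$. For a nonzero ideal $I$ of $A$ let $I_\nu=(A:(A:I))$ be its divisorial closure, where $(A:F)=\{x\in K : xF\subseteq A\}$, and call $I$ \emph{divisorial} if $I=I_\nu$. Say that $A$ has \emph{weak factorization} if every nonzero nondivisorial ideal $I$ of $A$ can be written as $I=I_\nu M_1M_2\cdots M_n$ with (not necessarily distinct) maximal ideals $M_1,\dots,M_n$ of $A$. Call a domain an \emph{SP-domain} if each of its ideals is a finite product of radical ideals. An \emph{overring} of $A$ is a ring $B$ with $A\subseteq B\subseteq K$. If $A$ is an ISP-domain which has weak factorization and $B$ is an overring of $A$ of Krull dimension one, then $B$ is an SP-domain. -/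

import Mathlib

open scoped nonZeroDivisors

/-- An (integral) ideal `J` of a domain `A` is invertible if it is a unit in the monoid of
fractional ideals of `A` (inside the quotient field of `A`). -/
def IsInvertibleIdeal {A : Type*} [CommRing A] [IsDomain A] (J : Ideal A) : Prop :=
  IsUnit (J : FractionalIdeal A⁰ (FractionRing A))

/-- `A` is an ISP-domain (invertible semiprime domain): every proper nonzero ideal is a product
`J * Q₁ * ⋯ * Qₙ` with `n ≥ 1`, `J` an invertible ideal and every `Qᵢ` a proper radical ideal.
The factors `Qᵢ`, repetitions allowed, form the nonempty multiset `Q`. -/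
def IsISPDomain (A : Type*) [CommRing A] [IsDomain A] : Prop :=
  ∀ I : Ideal A, I ≠ ⊥ → I ≠ ⊤ →
    ∃ (J : Ideal A) (Q : Multiset (Ideal A)),
      IsInvertibleIdeal J ∧ Q ≠ 0 ∧ (∀ q ∈ Q, q ≠ ⊤ ∧ q.IsRadical) ∧ I = J * Q.prod

/-- `A` is an SP-domain: every ideal is a (finite) product of radical ideals. -/
def IsSPDomain (A : Type*) [CommRing A] [IsDomain A] : Prop :=
  ∀ I : Ideal A, ∃ Q : Multiset (Ideal A), (∀ q ∈ Q, q.IsRadical) ∧ I = Q.prod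

/-- The divisorial closure `I_ν = (A : (A : I))` of a nonzero ideal `I` of the domain `A`, where
`(A : F) = {x ∈ K | x F ⊆ A}`, `K` being the quotient field of `A`. -/
noncomputable def divisorialClosure {A : Type*} [CommRing A] [IsDomain A] (I : Ideal A) :
    FractionalIdeal A⁰ (FractionRing A) :=
  1 / (1 / (I : FractionalIdeal A⁰ (FractionRing A)))

/-- A nonzero ideal is divisorial if it equals its divisorial closure. -/
def IsDivisorialIdeal {A : Type*} [CommRing A] [IsDomain A] (I : Ideal A) : Prop :=
  (I : FractionalIdeal A⁰ (FractionRing A)) = divisorialClosure I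

/-- `A` has weak factorization: every nonzero nondivisorial ideal `I` is the product
`I_ν * M₁ * ⋯ * Mₙ` of its divisorial closure and finitely many (not necessarily distinct)
maximal ideals. -/
def HasWeakFactorization (A : Type*) [CommRing A] [IsDomain A] : Prop :=
  ∀ I : Ideal A, I ≠ ⊥ → ¬ IsDivisorialIdeal I →
    ∃ M : Multiset (Ideal A), (∀ m ∈ M, m.IsMaximal) ∧
      (I : FractionalIdeal A⁰ (FractionRing A)) =
        divisorialClosure I * (M.prod : Ideal A)

/-! In a local domain with the factorization property the maximal ideal, if nonzero, is principal.
So the nonzero primes of `A` are locally principal, and `A` is a Prüfer domain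
(`dvdColon_sup_eq_top`). An overring `B` is then, at each of its primes, a localization of `A`; it
inherits the factorization with a finitely generated first factor, and in dimension one it is almost
Dedekind: ideals are governed by their orders at the maximal ideals.

Call `N` critical if every finitely generated ideal inside `N` lies in the square of some maximal
ideal. Without critical maximal ideals, having order less than `k` is an open condition, orders of a
nonzero ideal `C` are bounded, and `C` is the product of the radical ideals `Q k = ⋂ {N | C ≤ N ^ (k
+ 1)}` (`IsAlmostDedekind.isSPDomain`).

Weak factorization shows that a nonzero element of `B` lies in only finitely many nonisolated
maximal ideals (`finite_not_isIsolated`). Hence each `N` contains a finitely generated ideal of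
order one whose other maximal overideals are isolated, and the inherited factorization then shows
that `N` is not critical (`exists_noncritical`). -/

/-- A form of the factorization property of an ISP-domain that does not mention fractional
ideals: the ideal `J` is invertible because it divides a nonzero principal ideal. -/
def HasInvRadFactorization (A : Type*) [CommRing A] : Prop :=
  ∀ I : Ideal A, I ≠ ⊥ → I ≠ ⊤ →
    ∃ (J J' : Ideal A) (a : A) (Q : Multiset (Ideal A)),
      a ≠ 0 ∧ J * J' = Ideal.span {a} ∧ Q ≠ 0 ∧ (∀ q ∈ Q, q ≠ ⊤ ∧ q.IsRadical) ∧ I = J * Q.prod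

/-! ### Invertible factors and localization. -/

theorem IsInvertibleIdeal.exists_mul_eq_span {A : Type*} [CommRing A] [IsDomain A] {J : Ideal A}
    (hJ : IsInvertibleIdeal J) :
    ∃ (J' : Ideal A) (a : A), a ≠ 0 ∧ J * J' = Ideal.span {a} := by
  obtain ⟨F, hF⟩ := hJ.exists_right_inv
  obtain ⟨a, J', ha, rfl⟩ := FractionalIdeal.exists_eq_spanSingleton_mul F
  refine ⟨J', a, ha, ?_⟩
  have ha' : algebraMap A (FractionRing A) a ≠ 0 := by
    simpa using ha
  have : ((J * J' : Ideal A) : FractionalIdeal A⁰ (FractionRing A))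
      = ((Ideal.span {a} : Ideal A) : FractionalIdeal A⁰ (FractionRing A)) := by
    rw [FractionalIdeal.coeIdeal_span_singleton, FractionalIdeal.coeIdeal_mul]
    calc (J : FractionalIdeal A⁰ (FractionRing A)) * J'
        = FractionalIdeal.spanSingleton A⁰ (algebraMap A (FractionRing A) a) *
          (J * (FractionalIdeal.spanSingleton A⁰ (algebraMap A (FractionRing A) a)⁻¹ * J')) := by
          rw [mul_left_comm, ← mul_assoc (FractionalIdeal.spanSingleton A⁰ _)
            (FractionalIdeal.spanSingleton A⁰ _), FractionalIdeal.spanSingleton_mul_spanSingleton,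
            mul_inv_cancel₀ ha', FractionalIdeal.spanSingleton_one, one_mul]
      _ = _ := by rw [hF, mul_one]
  exact FractionalIdeal.coeIdeal_injective this

theorem IsISPDomain.hasInvRadFactorization {A : Type*} [CommRing A] [IsDomain A]
    (h : IsISPDomain A) : HasInvRadFactorization A := by
  intro I h0 h1
  obtain ⟨J, Q, hJ, hQ, hq, rfl⟩ := h I h0 h1
  obtain ⟨J', a, ha, hm⟩ := hJ.exists_mul_eq_span
  exact ⟨J, J', a, Q, ha, hm, hQ, hq, rfl⟩

/-- Some product `x * y` is a unit times `a`, as otherwise `a` would lie in `a` times the maximal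
ideal; this `x` generates `J`. -/
theorem Ideal.eq_span_singleton_of_mul_eq_span {D : Type*} [CommRing D] [IsDomain D]
    [IsLocalRing D] {J J' : Ideal D} {a : D} (ha : a ≠ 0) (h : J * J' = Ideal.span {a}) :
    ∃ x, x ≠ 0 ∧ J = Ideal.span {x} := by
  have : ∃ x ∈ J, ∃ y ∈ J', ∃ u, IsUnit u ∧ x * y = a * u := by
    by_contra! hc
    have hle : J * J' ≤ Ideal.span {a} * IsLocalRing.maximalIdeal D := by
      rw [Ideal.mul_le]
      intro x hx y hy
      have : x * y ∈ Ideal.span {a} := h ▸ Ideal.mul_mem_mul hx hy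
      obtain ⟨u, hu⟩ := Ideal.mem_span_singleton'.1 this
      rw [mul_comm] at hu
      rw [Ideal.mem_span_singleton_mul]
      refine ⟨u, ?_, hu⟩
      rw [IsLocalRing.mem_maximalIdeal]
      intro hunit
      exact hc x hx y hy u hunit hu.symm
    rw [h, Ideal.span_singleton_le_iff_mem, Ideal.mem_span_singleton_mul] at hle
    obtain ⟨z, hz, hz'⟩ := hle
    have : z = 1 := mul_left_cancel₀ ha (by rw [hz', mul_one])
    subst this
    exact (Ideal.ne_top_iff_one _).1 (IsLocalRing.maximalIdeal.isMaximal D).ne_top hz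
  obtain ⟨x, hx, y, hy, u, ⟨u, rfl⟩, hxy⟩ := this
  have hxy0 : x * y ≠ 0 := by rw [hxy]; exact mul_ne_zero ha u.ne_zero
  refine ⟨x, left_ne_zero_of_mul hxy0, le_antisymm ?_ ((Ideal.span_singleton_le_iff_mem _).2 hx)⟩
  intro j hj
  have : j * y ∈ Ideal.span {a} := h ▸ Ideal.mul_mem_mul hj hy
  obtain ⟨c, hc⟩ := Ideal.mem_span_singleton'.1 this
  rw [Ideal.mem_span_singleton]
  refine ⟨(↑u⁻¹ : D) * c, mul_right_cancel₀ (right_ne_zero_of_mul hxy0) ?_⟩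
  calc j * y = a * c := by rw [← hc, mul_comm]
    _ = (a * u) * (↑u⁻¹ * c) := by rw [mul_assoc, Units.mul_inv_cancel_left]
    _ = (x * y) * (↑u⁻¹ * c) := by rw [hxy]
    _ = _ := by ring

/-- An ideal dividing a nonzero principal ideal can be cancelled. -/
theorem Ideal.mul_left_cancel_of_mul_eq_span {A : Type*} [CommRing A] [IsDomain A]
    {J J' I L : Ideal A} {a : A} (ha : a ≠ 0) (h : J * J' = Ideal.span {a}) (hIL : J * I = J * L) :
    I = L := by
  have : Ideal.span {a} * I = Ideal.span {a} * L := by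
    rw [← h, mul_comm J, mul_assoc, hIL, mul_assoc]
  exact (Ideal.span_singleton_mul_right_inj ha).1 this

theorem Ideal.IsRadical.map_of_isLocalization {A D : Type*} [CommRing A] [CommRing D] [Algebra A D]
    (S : Submonoid A) [IsLocalization S D] {q : Ideal A} (hq : q.IsRadical) :
    (q.map (algebraMap A D)).IsRadical := by
  rw [Ideal.isRadical_iff_pow_one_lt 2 one_lt_two]
  intro r hr
  obtain ⟨x, s, rfl⟩ := IsLocalization.exists_mk'_eq S r
  rw [sq, ← IsLocalization.mk'_mul, IsLocalization.mk'_mem_map_algebraMap_iff] at hr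
  obtain ⟨t, ht, hm⟩ := hr
  rw [IsLocalization.mk'_mem_map_algebraMap_iff]
  refine ⟨t, ht, hq ⟨2, ?_⟩⟩
  have := q.mul_mem_left t hm
  convert this using 1
  ring

theorem Ideal.multiset_prod_eq_top_iff {A : Type*} [CommRing A] (Q : Multiset (Ideal A)) :
    Q.prod = ⊤ ↔ ∀ q ∈ Q, q = ⊤ := by
  induction Q using Multiset.induction_on with
  | empty => simp
  | cons q Q ih =>
    rw [Multiset.prod_cons, Multiset.forall_mem_cons, ← ih]
    refine ⟨fun h => ⟨?_, ?_⟩, fun ⟨h1, h2⟩ => by rw [h1, h2, Ideal.top_mul]⟩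
    · exact top_le_iff.1 (h ▸ Ideal.mul_le_left)
    · exact top_le_iff.1 (h ▸ Ideal.mul_le_right)

theorem HasInvRadFactorization.localization {A D : Type*} [CommRing A] [IsDomain A] [CommRing D]
    [Algebra A D] (P : Ideal A) [P.IsPrime] [IsLocalization.AtPrime D P]
    (h : HasInvRadFactorization A) : HasInvRadFactorization D := by
  classical
  intro C h0 h1
  have hinj : Function.Injective (algebraMap A D) :=
    IsLocalization.injective D P.primeCompl_le_nonZeroDivisors
  have hmap : (C.comap (algebraMap A D)).map (algebraMap A D) = C :=
    IsLocalization.map_under P.primeCompl D C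
  obtain ⟨J, J', a, Q, ha, hJ, hQ, hq, hI⟩ := h (C.comap (algebraMap A D))
    (by intro hb; rw [hb, Ideal.map_bot] at hmap; exact h0 hmap.symm)
    (by intro hb; rw [hb, Ideal.map_top] at hmap; exact h1 hmap.symm)
  have hmapQ : (Q.prod).map (algebraMap A D) = (Q.map (Ideal.map (algebraMap A D))).prod :=
    map_multiset_prod (Ideal.mapHom (algebraMap A D)) Q
  set R := (Q.map (Ideal.map (algebraMap A D))).filter (fun q => q ≠ ⊤) with hR
  have hprod : (Q.map (Ideal.map (algebraMap A D))).prod = R.prod := by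
    rw [← Multiset.filter_add_not (fun q => q ≠ ⊤) (Q.map (Ideal.map (algebraMap A D))),
      Multiset.prod_add, (Ideal.multiset_prod_eq_top_iff (Multiset.filter (fun q => ¬ q ≠ ⊤) _)).2, Ideal.mul_top]
    intro q hq
    simpa using (Multiset.mem_filter.1 hq).2
  have hC : C = J.map (algebraMap A D) * R.prod := by
    rw [← hprod, ← hmapQ, ← Ideal.map_mul, ← hI, hmap]
  refine ⟨J.map (algebraMap A D), J'.map (algebraMap A D), algebraMap A D a, R, ?_, ?_, ?_, ?_, hC⟩
  · simpa using (map_ne_zero_iff _ hinj).2 ha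
  · rw [← Ideal.map_mul, hJ, Ideal.map_span, Set.image_singleton]
  -- If all radical factors became trivial, `C` would be the extension of `J`, so `J * Q.prod = J`,
  -- and cancelling `J` contradicts properness.
  · intro hR0
    rw [hR0, Multiset.prod_zero, mul_one] at hC
    have hle : C.comap (algebraMap A D) = J :=
      le_antisymm (hI ▸ Ideal.mul_le_left) (Ideal.map_le_iff_le_comap.1 hC.ge)
    have : J * ⊤ = J * Q.prod := by rw [Ideal.mul_top, ← hI, hle]
    have := (Ideal.multiset_prod_eq_top_iff Q).1 (Ideal.mul_left_cancel_of_mul_eq_span ha hJ this).symm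
    obtain ⟨q, hqQ⟩ := Multiset.exists_mem_of_ne_zero hQ
    exact (hq q hqQ).1 (this q hqQ)
  · intro q hqR
    obtain ⟨hq1, hq2⟩ := Multiset.mem_filter.1 hqR
    obtain ⟨q', hq', rfl⟩ := Multiset.mem_map.1 hq1
    exact ⟨hq2, (hq q' hq').2.map_of_isLocalization P.primeCompl⟩

/-! ### Local domains: the maximal ideal is principal. -/

theorem HasInvRadFactorization.exists_span_mul {D : Type*} [CommRing D] [IsDomain D]
    [IsLocalRing D] (h : HasInvRadFactorization D) {I : Ideal D} (h0 : I ≠ ⊥) (h1 : I ≠ ⊤) :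
    ∃ (x : D) (Q : Multiset (Ideal D)), x ≠ 0 ∧ Q ≠ 0 ∧ (∀ q ∈ Q, q ≠ ⊤ ∧ q.IsRadical) ∧
      I = Ideal.span {x} * Q.prod := by
  obtain ⟨J, J', a, Q, ha, hJ, hQ, hq, rfl⟩ := h I h0 h1
  obtain ⟨x, hx, rfl⟩ := Ideal.eq_span_singleton_of_mul_eq_span ha hJ
  exact ⟨x, Q, hx, hQ, hq, rfl⟩

-- Each radical factor contains `C`, hence its radical, and so is the maximal ideal.
open IsLocalRing in
theorem HasInvRadFactorization.exists_span_mul_pow {D : Type*} [CommRing D] [IsDomain D]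
    [IsLocalRing D] (h : HasInvRadFactorization D) {C : Ideal D} (h0 : C ≠ ⊥)
    (hC : C.radical = maximalIdeal D) :
    ∃ (x : D) (k : ℕ), x ≠ 0 ∧ C = Ideal.span {x} * maximalIdeal D ^ (k + 1) := by
  have h1 : C ≠ ⊤ := by
    rintro rfl
    rw [Ideal.radical_top] at hC
    exact (maximalIdeal.isMaximal D).ne_top hC.symm
  obtain ⟨x, Q, hx, hQ, hq, hCx⟩ := h.exists_span_mul h0 h1
  have hall : ∀ q ∈ Q, q = maximalIdeal D := by
    intro q hqQ
    have h2 : C ≤ q := by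
      rw [hCx]
      exact Ideal.mul_le_right.trans (Ideal.le_of_dvd (Multiset.dvd_prod hqQ))
    exact le_antisymm (le_maximalIdeal (hq q hqQ).1)
      (hC ▸ (hq q hqQ).2.radical_le_iff.2 h2)
  rw [Multiset.eq_replicate_of_mem hall, Multiset.prod_replicate] at hCx
  obtain ⟨k, hk⟩ := Nat.exists_eq_succ_of_ne_zero (mt Multiset.card_eq_zero.1 hQ)
  exact ⟨x, k, hx, by rw [hCx, hk]⟩

-- The factorization of `(c)` exhibits the maximal ideal as a divisor of a nonzero principal ideal.
open IsLocalRing in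
theorem HasInvRadFactorization.maximalIdeal_eq_span_of_radical_span {D : Type*} [CommRing D]
    [IsDomain D] [IsLocalRing D] (h : HasInvRadFactorization D) {c : D} (h0 : c ≠ 0)
    (hC : (Ideal.span {c}).radical = maximalIdeal D) :
    ∃ n, n ≠ 0 ∧ maximalIdeal D = Ideal.span {n} := by
  obtain ⟨x, k, hx, hc⟩ := h.exists_span_mul_pow (by simpa using h0) hC
  refine Ideal.eq_span_singleton_of_mul_eq_span (J' := Ideal.span {x} * maximalIdeal D ^ k) h0 ?_
  rw [hc]; ring

-- A nonunit principal factor would be a principal ideal with radical the maximal ideal, against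
-- `hM`.
open IsLocalRing in
theorem HasInvRadFactorization.eq_pow_of_radical_eq {D : Type*} [CommRing D]
    [IsDomain D] [IsLocalRing D] (h : HasInvRadFactorization D) 
    (hM : ¬ ∃ n, n ≠ 0 ∧ maximalIdeal D = Ideal.span {n}) {C : Ideal D} (h0 : C ≠ ⊥)
    (hC : C.radical = maximalIdeal D) : ∃ k, C = maximalIdeal D ^ (k + 1) := by
  obtain ⟨x, k, hx, hc⟩ := h.exists_span_mul_pow h0 hC
  refine ⟨k, ?_⟩
  by_cases hu : IsUnit x
  · rwa [Ideal.span_singleton_eq_top.2 hu, Ideal.top_mul] at hc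
  · refine absurd (h.maximalIdeal_eq_span_of_radical_span hx (le_antisymm ?_ ?_)) hM
    · refine (maximalIdeal.isMaximal D).isPrime.isRadical.radical_le_iff.2 ?_
      rwa [Ideal.span_singleton_le_iff_mem, mem_maximalIdeal]
    · rw [← hC]
      exact Ideal.radical_mono (hc ▸ Ideal.mul_le_left)

open IsLocalRing in
theorem Ideal.eq_span_of_sup_maximalIdeal_mul {D : Type*} [CommRing D] [IsLocalRing D]
    {I J : Ideal D} (hI : I.FG) (hJ : J ≤ I) (h : I ≤ J ⊔ maximalIdeal D * I) : I = J :=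
  le_antisymm (Submodule.le_of_le_smul_of_le_jacobson_bot hI
    (maximalIdeal_le_jacobson _) h) hJ

open IsLocalRing in
/-- If the maximal ideal is the radical of a finitely generated nonzero ideal, it is principal. -/
theorem HasInvRadFactorization.maximalIdeal_eq_span_of_radical_fg {D : Type*} [CommRing D]
    [IsDomain D] [IsLocalRing D] (h : HasInvRadFactorization D) {I : Ideal D} (hfg : I.FG)
    (h0 : I ≠ ⊥) (hI : I.radical = maximalIdeal D) :
    ∃ n, n ≠ 0 ∧ maximalIdeal D = Ideal.span {n} := by
  by_contra hM
  obtain ⟨k, hk⟩ := h.eq_pow_of_radical_eq hM h0 hI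
  -- By Nakayama the powers drop strictly here. For `y` in the gap, `(y)` plus the smaller power is
  -- again a power, hence contains `I`; Nakayama then gives `I = (y)`.
  have hlt : ¬ maximalIdeal D ^ (k + 1) ≤ maximalIdeal D ^ (k + 2) := by
    intro hle
    have := Ideal.eq_span_of_sup_maximalIdeal_mul (I := I) (J := ⊥) hfg bot_le
      (by rw [hk, bot_sup_eq, ← pow_succ']; exact hle)
    exact h0 this
  obtain ⟨y, hy, hy'⟩ := SetLike.not_le_iff_exists.1 hlt
  have hy0 : y ≠ 0 := by rintro rfl; exact hy' (zero_mem _)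
  have hrad : (Ideal.span {y} ⊔ maximalIdeal D ^ (k + 2)).radical = maximalIdeal D := by
    refine le_antisymm ((maximalIdeal.isMaximal D).isPrime.isRadical.radical_le_iff.2 ?_) ?_
    · exact sup_le ((Ideal.span_singleton_le_iff_mem _).2 (Ideal.pow_le_self (Nat.succ_ne_zero _) hy))
        (Ideal.pow_le_self (Nat.succ_ne_zero _))
    · exact fun z hz => ⟨k + 2, le_sup_right (a := Ideal.span {y}) (Ideal.pow_mem_pow hz _)⟩
  have hyle : Ideal.span {y} ≤ Ideal.span {y} ⊔ maximalIdeal D ^ (k + 2) := le_sup_left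
  rw [Ideal.span_singleton_le_iff_mem] at hyle
  obtain ⟨m, hm⟩ := h.eq_pow_of_radical_eq hM (by
    rintro hb; rw [hb] at hyle; exact hy0 (by simpa using hyle)) hrad
  rw [hm] at hyle
  have hmk : m ≤ k := by
    by_contra! hc
    exact hy' (Ideal.pow_le_pow_right (by omega) hyle)
  have heq := Ideal.eq_span_of_sup_maximalIdeal_mul (I := I) (J := Ideal.span {y}) hfg
    (by rw [hk]; exact (Ideal.span_singleton_le_iff_mem _).2 hy)
    (by rw [hk, ← pow_succ', hm]; exact Ideal.pow_le_pow_right (by omega))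
  exact hM (h.maximalIdeal_eq_span_of_radical_span hy0 (heq ▸ hI))

open IsLocalRing in
/-- The localization at a prime minimal over an ideal has the extension of this ideal primary
to its maximal ideal. -/
theorem Ideal.radical_map_eq_maximalIdeal {A D : Type*} [CommRing A] [CommRing D] [Algebra A D]
    [IsLocalRing D] {I N : Ideal A} [N.IsPrime] [IsLocalization.AtPrime D N]
    (hN : N ∈ I.minimalPrimes) :
    (I.map (algebraMap A D)).radical = maximalIdeal D := by
  have hmc : (maximalIdeal D).comap (algebraMap A D) = N :=
    IsLocalization.AtPrime.under_maximalIdeal D N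
  have hle : I.map (algebraMap A D) ≤ maximalIdeal D := by
    rw [Ideal.map_le_iff_le_comap, hmc]; exact hN.1.2
  refine le_antisymm ((maximalIdeal.isMaximal D).isPrime.isRadical.radical_le_iff.2 hle) ?_
  rw [Ideal.radical_eq_sInf]
  refine le_sInf ?_
  rintro P ⟨hIP, hP⟩
  have h1 : P.comap (algebraMap A D) ≤ N := hmc ▸ Ideal.comap_mono (le_maximalIdeal hP.ne_top)
  have h2 := hN.2 ⟨hP.comap _, Ideal.map_le_iff_le_comap.1 hIP⟩ h1
  calc maximalIdeal D = ((maximalIdeal D).comap (algebraMap A D)).map (algebraMap A D) :=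
        (IsLocalization.map_under N.primeCompl D _).symm
    _ ≤ P := by rw [hmc, Ideal.map_le_iff_le_comap]; exact h2

open IsLocalRing in
/-- A radical principal ideal of a local domain has no proper divisors that are principal. -/
theorem HasInvRadFactorization.isUnit_or_isUnit_of_isRadical {D : Type*} [CommRing D]
    [IsDomain D] (h : HasInvRadFactorization D) [IsLocalRing D] {x r : D} (h0 : x * r ≠ 0)
    (hq : (Ideal.span {x * r}).IsRadical) : IsUnit x ∨ IsUnit r := by
  by_contra! hc
  have hle : Ideal.span {x, r} ≤ maximalIdeal D := by
    rw [Ideal.span_le]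
    rintro z (rfl | rfl)
    · exact (mem_maximalIdeal _).2 hc.1
    · exact (mem_maximalIdeal _).2 hc.2
  -- Localized at `N`, the maximal ideal is some `(n)`. With `x = a n` and `r = b n`, radicality
  -- puts `n a b` into `(n² a b)`, making `n` a unit.
  obtain ⟨N, hN, hNM⟩ := Ideal.exists_minimalPrimes_le hle
  have := hN.1.1
  have hinj := IsLocalization.injective (Localization.AtPrime N) N.primeCompl_le_nonZeroDivisors
  have hD := h.localization (D := Localization.AtPrime N) N
  have hrad := Ideal.radical_map_eq_maximalIdeal (D := Localization.AtPrime N) hN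
  set f := algebraMap D (Localization.AtPrime N) with hf
  have hx0 : f x ≠ 0 := by simpa using (map_ne_zero_iff f hinj).2 (left_ne_zero_of_mul h0)
  have hr0 : f r ≠ 0 := by simpa using (map_ne_zero_iff f hinj).2 (right_ne_zero_of_mul h0)
  have hxN : x ∈ N := hN.1.2 (Ideal.subset_span (by simp))
  have hrN : r ∈ N := hN.1.2 (Ideal.subset_span (by simp))
  have hmem : ∀ z ∈ N, f z ∈ maximalIdeal (Localization.AtPrime N) := fun z hz =>
    (IsLocalization.AtPrime.to_map_mem_maximal_iff _ N z).2 hz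
  obtain ⟨n, hn0, hn⟩ := hD.maximalIdeal_eq_span_of_radical_fg
    (Ideal.FG.map (Submodule.fg_span (by simp)) f)
    (by
      intro hb
      have : f x ∈ (Ideal.span {x, r}).map f := Ideal.mem_map_of_mem _ (Ideal.subset_span (by simp))
      rw [hb] at this
      exact hx0 (by simpa using this)) hrad
  have hx := hmem x hxN
  have hr := hmem r hrN
  rw [hn, Ideal.mem_span_singleton'] at hx hr
  obtain ⟨a, ha⟩ := hx
  obtain ⟨b, hb⟩ := hr
  have hrad' : (Ideal.span {f x * f r}).IsRadical := by
    have := hq.map_of_isLocalization (D := Localization.AtPrime N) N.primeCompl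
    rwa [Ideal.map_span, Set.image_singleton, map_mul] at this
  have : n * a * b ∈ Ideal.span {f x * f r} := by
    refine hrad' ⟨2, ?_⟩
    rw [Ideal.mem_span_singleton', ← ha, ← hb]
    exact ⟨a * b, by ring⟩
  rw [Ideal.mem_span_singleton', ← ha, ← hb] at this
  obtain ⟨c, hc⟩ := this
  have ha0 : a ≠ 0 := by rintro rfl; exact hx0 (by rw [← ha, zero_mul])
  have hb0 : b ≠ 0 := by rintro rfl; exact hr0 (by rw [← hb, zero_mul])
  have hcn : c * n = 1 := by
    apply mul_right_cancel₀ (mul_ne_zero (mul_ne_zero hn0 ha0) hb0)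
    linear_combination hc
  have : n ∈ maximalIdeal (Localization.AtPrime N) := hn ▸ Ideal.mem_span_singleton_self n
  exact (mem_maximalIdeal _).1 this (IsUnit.of_mul_eq_one_right c hcn)

/-- The ideal `(c : b)` of all `x` such that `c` divides `b * x`. -/
def Ideal.dvdColon {A : Type*} [CommRing A] (c b : A) : Ideal A where
  carrier := {x | c ∣ b * x}
  add_mem' hx hy := by simpa [mul_add] using dvd_add hx hy
  zero_mem' := by simp
  smul_mem' r x hx := by
    change c ∣ b * (r * x)
    rw [mul_left_comm]
    exact Dvd.dvd.mul_left hx r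

theorem Ideal.mem_dvdColon {A : Type*} [CommRing A] {c b x : A} :
    x ∈ Ideal.dvdColon c b ↔ c ∣ b * x := Iff.rfl

-- In `q = x * r` the cofactor `r` lies in a proper radical factor, so `x` is a unit and the
-- principal factor disappears.
open IsLocalRing in
theorem HasInvRadFactorization.exists_eq_prod_of_mem {D : Type*} [CommRing D] [IsDomain D]
    [IsLocalRing D] (h : HasInvRadFactorization D) {q : D} (hq0 : q ≠ 0)
    (hq : (Ideal.span {q}).IsRadical) {C : Ideal D} (hqC : q ∈ C) (hC : C ≠ ⊤) :
    ∃ Q : Multiset (Ideal D), Q ≠ 0 ∧ (∀ q ∈ Q, q ≠ ⊤ ∧ q.IsRadical) ∧ C = Q.prod := by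
  obtain ⟨x, Q, hx, hQ, hQr, hCx⟩ := h.exists_span_mul
    (by rintro rfl; exact hq0 (by simpa using hqC)) hC
  rw [hCx, Ideal.mem_span_singleton_mul] at hqC
  obtain ⟨r, hr, rfl⟩ := hqC
  have hru : ¬ IsUnit r := by
    obtain ⟨p, hp⟩ := Multiset.exists_mem_of_ne_zero hQ
    intro hu
    exact (hQr p hp).1 (Ideal.eq_top_of_isUnit_mem _
      (Ideal.le_of_dvd (Multiset.dvd_prod hp) hr) hu)
  have hxu := (h.isUnit_or_isUnit_of_isRadical hq0 hq).resolve_right hru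
  refine ⟨Q, hQ, hQr, ?_⟩
  rw [hCx, Ideal.span_singleton_eq_top.2 hxu, Ideal.top_mul]

open IsLocalRing in
theorem HasInvRadFactorization.isRadical_of_mem {D : Type*} [CommRing D] [IsDomain D]
    [IsLocalRing D] (h : HasInvRadFactorization D) {q : D} (hq0 : q ≠ 0)
    (hq : (Ideal.span {q}).IsRadical) {C : Ideal D} (hqC : q ∈ C) (hC : C ≠ ⊤)
    (hC2 : ¬ C ≤ maximalIdeal D ^ 2) : C.IsRadical := by
  obtain ⟨Q, hQ, hQr, rfl⟩ := h.exists_eq_prod_of_mem hq0 hq hqC hC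
  obtain ⟨p, hp⟩ := Multiset.exists_mem_of_ne_zero hQ
  obtain ⟨Q, rfl⟩ := Multiset.exists_cons_of_mem hp
  rcases eq_or_ne Q 0 with rfl | hQ'
  · simpa using (hQr p hp).2
  · obtain ⟨p', hp'⟩ := Multiset.exists_mem_of_ne_zero hQ'
    obtain ⟨Q, rfl⟩ := Multiset.exists_cons_of_mem hp'
    refine absurd ?_ hC2
    rw [Multiset.prod_cons, Multiset.prod_cons, ← mul_assoc, sq]
    exact Ideal.mul_le_left.trans (Ideal.mul_mono (le_maximalIdeal (hQr p hp).1)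
      (le_maximalIdeal (hQr p' (by simp)).1))

-- The primary case of `maximalIdeal_eq_span_of_isRadical`. If `a ∉ (q)`, radicality keeps `a` out
-- of `(q : a) + (a²)`, so the maximal ideal is not idempotent. For `m` outside its square, every
-- proper ideal containing `q` and `m` is radical, which makes the maximal ideal equal to `(q, m)`,
-- hence principal, hence generated by `q`.
open IsLocalRing in
theorem HasInvRadFactorization.mem_span_of_radical_colon_sup {D : Type*} [CommRing D] [IsDomain D]
    [IsLocalRing D] (h : HasInvRadFactorization D) {q : D} (hq0 : q ≠ 0)
    (hq : (Ideal.span {q}).IsRadical) (hqM : q ∈ maximalIdeal D) {a : D}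
    (hrad : (Ideal.dvdColon q a ⊔ Ideal.span {a}).radical
      = maximalIdeal D) : a ∈ Ideal.span {q} := by
  by_contra ha
  set H : Ideal D := Ideal.dvdColon q a with hH
  have hmemH : ∀ x, x ∈ H ↔ a * x ∈ Ideal.span {q} :=
    fun x => Ideal.mem_span_singleton.symm
  have hqH : q ∈ H := (hmemH q).2 (Ideal.mul_mem_left _ _ (Ideal.mem_span_singleton_self q))
  have hMtop := (maximalIdeal.isMaximal D).ne_top
  have hpow : ∀ C : Ideal D, q ∈ C → C.radical = maximalIdeal D →
      ∃ k, C = maximalIdeal D ^ (k + 1) := by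
    intro C hqC hC
    have hCle : C ≤ maximalIdeal D := hC ▸ Ideal.le_radical
    obtain ⟨Q, hQ, hQr, hCQ⟩ := h.exists_eq_prod_of_mem hq0 hq hqC
      (fun ht => hMtop (top_le_iff.1 (ht ▸ hCle)))
    have hall : ∀ p ∈ Q, p = maximalIdeal D := fun p hp =>
      le_antisymm (le_maximalIdeal (hQr p hp).1) (hC ▸ (hQr p hp).2.radical_le_iff.2
        (hCQ ▸ Ideal.le_of_dvd (Multiset.dvd_prod hp)))
    rw [Multiset.eq_replicate_of_mem hall, Multiset.prod_replicate] at hCQ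
    obtain ⟨k, hk⟩ := Nat.exists_eq_succ_of_ne_zero (mt Multiset.card_eq_zero.1 hQ)
    exact ⟨k, by rw [hCQ, hk]⟩
  have haM : a ∈ maximalIdeal D :=
    hrad ▸ Ideal.le_radical (Ideal.mem_sup_right (Ideal.mem_span_singleton_self a))
  have hrad2 : (H ⊔ Ideal.span {a ^ 2}).radical = maximalIdeal D := by
    rw [← hrad, Ideal.radical_sup H, Ideal.radical_sup H, ← Ideal.span_singleton_pow,
      Ideal.radical_pow _ two_ne_zero]
  obtain ⟨k, hk⟩ := hpow _ (Ideal.mem_sup_left hqH) hrad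
  obtain ⟨l, hl⟩ := hpow _ (Ideal.mem_sup_left hqH) hrad2
  have hunit : ∀ c, ∀ b ∈ maximalIdeal D, IsUnit (1 - c * b) := by
    intro c b hb
    by_contra hu
    have := Ideal.add_mem _ ((mem_maximalIdeal _).2 hu) (Ideal.mul_mem_left _ c hb)
    rw [sub_add_cancel] at this
    exact hMtop ((Ideal.eq_top_iff_one _).2 this)
  have hcancel : ∀ (C : Ideal D) (c b : D), b ∈ maximalIdeal D → b - c * b ^ 2 ∈ C → b ∈ C := by
    intro C c b hb hC
    refine (Ideal.unit_mul_mem_iff_mem C (hunit c b hb)).1 ?_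
    convert hC using 1
    ring
  have ha2 : a ∉ H ⊔ Ideal.span {a ^ 2} := by
    intro hmem
    obtain ⟨y, hy, z, hz, hyz⟩ := Submodule.mem_sup.1 hmem
    obtain ⟨c, rfl⟩ := Ideal.mem_span_singleton'.1 hz
    have : a ∈ H := hcancel H c a haM (by rwa [← eq_sub_of_add_eq hyz])
    rw [hmemH] at this
    exact ha (hq ⟨2, by rwa [sq]⟩)
  have hM2 : ¬ maximalIdeal D ≤ maximalIdeal D ^ 2 := by
    intro hle
    have hid : IsIdempotentElem (maximalIdeal D) :=
      le_antisymm Ideal.mul_le_left (by rwa [← sq])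
    rw [hid.pow_succ_eq] at hl
    exact ha2 (hl ▸ haM)
  obtain ⟨m, hm, hm2⟩ := SetLike.not_le_iff_exists.1 hM2
  have hradC : ∀ C : Ideal D, q ∈ C → m ∈ C → C ≤ maximalIdeal D → C.IsRadical :=
    fun C hqC hmC hCM => h.isRadical_of_mem hq0 hq hqC (fun ht => hMtop (top_le_iff.1 (ht ▸ hCM)))
      (fun hle => hm2 (hle hmC))
  have hM : maximalIdeal D = Ideal.span {q, m} := by
    have hle : Ideal.span {q, m} ≤ maximalIdeal D := by
      rw [Ideal.span_le]
      rintro z (rfl | rfl)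
      exacts [hqM, hm]
    -- The radical ideal `(q, m, b²)` contains `b`; since `1 - c * b` is a unit, `b²` can be
    -- dropped.
    refine le_antisymm (fun b hb => ?_) hle
    have h1 := hradC (Ideal.span {q, m} ⊔ Ideal.span {b ^ 2})
      (Ideal.mem_sup_left (Ideal.subset_span (by simp)))
      (Ideal.mem_sup_left (Ideal.subset_span (by simp)))
      (sup_le hle ((Ideal.span_singleton_le_iff_mem _).2 (Ideal.pow_mem_of_mem _ hb 2 two_pos)))
    have h2 : b ∈ Ideal.span {q, m} ⊔ Ideal.span {b ^ 2} :=
      h1 ⟨2, Ideal.mem_sup_right (Ideal.mem_span_singleton_self _)⟩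
    obtain ⟨y, hy, z, hz, hyz⟩ := Submodule.mem_sup.1 h2
    obtain ⟨c, rfl⟩ := Ideal.mem_span_singleton'.1 hz
    exact hcancel _ c b hb (by rwa [← eq_sub_of_add_eq hyz])
  obtain ⟨n, hn0, hn⟩ := h.maximalIdeal_eq_span_of_radical_fg
    (I := maximalIdeal D) (hM ▸ Submodule.fg_span (by simp))
    (by rintro hb; rw [hb] at hqM; exact hq0 (by simpa using hqM))
    (maximalIdeal.isMaximal D).isPrime.isRadical.radical
  have hqn := hqM
  rw [hn, Ideal.mem_span_singleton'] at hqn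
  obtain ⟨c, rfl⟩ := hqn
  have hnu : ¬ IsUnit n := by
    rw [← mem_nonunits_iff, ← mem_maximalIdeal, hn]
    exact Ideal.mem_span_singleton_self n
  have hcu := (h.isUnit_or_isUnit_of_isRadical hq0 hq).resolve_right hnu
  rw [mul_comm, Ideal.span_singleton_mul_right_unit hcu, ← hn] at ha
  exact ha haM

open IsLocalRing in
/-- In a local domain with the factorization property, every radical principal proper ideal
is the maximal ideal. -/
theorem HasInvRadFactorization.maximalIdeal_eq_span_of_isRadical {D : Type*} [CommRing D]
    [IsDomain D] [IsLocalRing D] (h : HasInvRadFactorization D) {q : D} (hq0 : q ≠ 0)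
    (hq : (Ideal.span {q}).IsRadical) (hqM : q ∈ maximalIdeal D) :
    maximalIdeal D = Ideal.span {q} := by
  refine le_antisymm (fun a haM => ?_) ((Ideal.span_singleton_le_iff_mem _).2 hqM)
  by_contra ha
  set H : Ideal D := Ideal.dvdColon q a with hH
  have hmemH : ∀ x, x ∈ H ↔ a * x ∈ Ideal.span {q} :=
    fun x => Ideal.mem_span_singleton.symm
  have hHM : H ⊔ Ideal.span {a} ≤ maximalIdeal D := by
    refine sup_le (le_maximalIdeal fun ht => ha ?_) ((Ideal.span_singleton_le_iff_mem _).2 haM)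
    simpa [hmemH] using (Ideal.eq_top_iff_one _).1 ht
  -- Localizing at `N` reduces to the primary case; `a` stays outside `(q)` there because `(q : a)`
  -- lies in `N`.
  obtain ⟨N, hN, hNM⟩ := Ideal.exists_minimalPrimes_le hHM
  have := hN.1.1
  have hinj := IsLocalization.injective (Localization.AtPrime N) N.primeCompl_le_nonZeroDivisors
  have hD := h.localization (D := Localization.AtPrime N) N
  have hrad := Ideal.radical_map_eq_maximalIdeal (D := Localization.AtPrime N) hN
  set f := algebraMap D (Localization.AtPrime N) with hf
  have hmem : ∀ z ∈ N, f z ∈ maximalIdeal (Localization.AtPrime N) := fun z hz =>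
    (IsLocalization.AtPrime.to_map_mem_maximal_iff _ N z).2 hz
  have hqH : q ∈ H := (hmemH q).2 (Ideal.mul_mem_left _ _ (Ideal.mem_span_singleton_self q))
  have hsq : (Ideal.span {q}).map f = Ideal.span {f q} := by
    rw [Ideal.map_span, Set.image_singleton]
  have hqN : q ∈ N := hN.1.2 (Ideal.mem_sup_left hqH)
  have hfa : f a ∉ Ideal.span {f q} := by
    rw [← hsq, hf, IsLocalization.algebraMap_mem_map_algebraMap_iff N.primeCompl]
    rintro ⟨s, hs, hsa⟩
    exact hs (hN.1.2 (Ideal.mem_sup_left ((hmemH s).2 (by rwa [mul_comm]))))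
  refine hfa (hD.mem_span_of_radical_colon_sup (by simpa using (map_ne_zero_iff f hinj).2 hq0)
    (hsq ▸ hq.map_of_isLocalization N.primeCompl) (hmem q hqN) (le_antisymm ?_ ?_))
  · refine (maximalIdeal.isMaximal _).isPrime.isRadical.radical_le_iff.2 (sup_le ?_ ?_)
    · refine le_maximalIdeal fun ht => hfa ?_
      have := (Ideal.eq_top_iff_one _).1 ht
      rw [Ideal.mem_dvdColon, mul_one] at this
      exact Ideal.mem_span_singleton.2 this
    · exact (Ideal.span_singleton_le_iff_mem _).2
        (hmem a (hN.1.2 (Ideal.mem_sup_right (Ideal.mem_span_singleton_self a))))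
  · rw [← hrad]
    refine Ideal.radical_mono ?_
    rw [Ideal.map_sup, Ideal.map_span, Set.image_singleton]
    refine sup_le_sup_right (Ideal.map_le_iff_le_comap.2 fun x hx => ?_) _
    change f q ∣ f a * f x
    rw [← Ideal.mem_span_singleton, ← hsq, ← map_mul]
    exact Ideal.mem_map_of_mem f ((hmemH x).1 hx)

-- A radical factor of a nonzero principal ideal is itself principal, so
-- `maximalIdeal_eq_span_of_isRadical` applies to it.
open IsLocalRing in
theorem HasInvRadFactorization.exists_maximalIdeal_eq_span {D : Type*} [CommRing D]
    [IsDomain D] [IsLocalRing D] (h : HasInvRadFactorization D) (hD : maximalIdeal D ≠ ⊥) :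
    ∃ q, q ≠ 0 ∧ maximalIdeal D = Ideal.span {q} := by
  obtain ⟨y, hy, hy0⟩ := Submodule.exists_mem_ne_zero_of_ne_bot hD
  obtain ⟨x, Q, hx, hQ, hQr, hxQ⟩ := h.exists_span_mul (I := Ideal.span {y}) (by simpa using hy0)
    (by rwa [Ne, Ideal.span_singleton_eq_top])
  obtain ⟨p, hp⟩ := Multiset.exists_mem_of_ne_zero hQ
  obtain ⟨Q, rfl⟩ := Multiset.exists_cons_of_mem hp
  obtain ⟨q, hq0, rfl⟩ := Ideal.eq_span_singleton_of_mul_eq_span (J := p)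
    (J' := Ideal.span {x} * Q.prod) hy0 (by rw [hxQ, Multiset.prod_cons]; ring)
  exact ⟨q, hq0, h.maximalIdeal_eq_span_of_isRadical hq0 (hQr _ hp).2
    (le_maximalIdeal (hQr _ hp).1 (Ideal.mem_span_singleton_self q))⟩

/-! ### Local generators of primes and the Prüfer property. -/

/-- Every nonzero prime is locally principal. -/
theorem HasInvRadFactorization.exists_locally_dvd {A : Type*} [CommRing A]
    [IsDomain A] (h : HasInvRadFactorization A) (P : Ideal A) [P.IsPrime] (hP : P ≠ ⊥) :
    ∃ π ∈ P, ∀ x ∈ P, ∃ s ∉ P, π ∣ s * x := by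
  have hinj := IsLocalization.injective (Localization.AtPrime P) P.primeCompl_le_nonZeroDivisors
  have hD := h.localization (D := Localization.AtPrime P) P
  obtain ⟨y, hy, hy0⟩ := Submodule.exists_mem_ne_zero_of_ne_bot hP
  have hmem : ∀ z, algebraMap A (Localization.AtPrime P) z ∈
      IsLocalRing.maximalIdeal (Localization.AtPrime P) ↔ z ∈ P := fun z =>
    IsLocalization.AtPrime.to_map_mem_maximal_iff _ P z
  obtain ⟨q, hq0, hq⟩ := hD.exists_maximalIdeal_eq_span (by
    intro hb
    have := (hmem y).2 hy
    rw [hb] at this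
    exact hy0 ((map_eq_zero_iff _ hinj).1 (by simpa using this)))
  obtain ⟨π, s, rfl⟩ := IsLocalization.exists_mk'_eq P.primeCompl q
  have hassoc : Ideal.span {IsLocalization.mk' (Localization.AtPrime P) π s} =
      Ideal.span {algebraMap A (Localization.AtPrime P) π} := by
    rw [← IsLocalization.mk'_spec (Localization.AtPrime P) π s]
    exact (Ideal.span_singleton_mul_right_unit (IsLocalization.map_units _ s) _).symm
  rw [hassoc] at hq
  refine ⟨π, (hmem π).1 (hq ▸ Ideal.mem_span_singleton_self _), fun x hx => ?_⟩
  have h1 := (hmem x).2 hx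
  rw [hq, ← Set.image_singleton, ← Ideal.map_span,
    IsLocalization.algebraMap_mem_map_algebraMap_iff P.primeCompl] at h1
  obtain ⟨t, ht, h2⟩ := h1
  exact ⟨t, ht, Ideal.mem_span_singleton.1 h2⟩

/-- A valuation at `P` truncated at `k`: the second alternative gives the exact order `l`, up to
multipliers outside `P`. -/
theorem Ideal.exists_pow_dvd_or {A : Type*} [CommRing A] (P : Ideal A) [P.IsPrime] {π : A}
    (hπ : ∀ x ∈ P, ∃ s ∉ P, π ∣ s * x) (z : A) (k : ℕ) :
    (∃ r ∉ P, π ^ k ∣ r * z) ∨ ∃ l < k, ∃ r ∉ P, ∃ v ∉ P, r * z = π ^ l * v := by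
  induction k with
  | zero => exact Or.inl ⟨1, Ideal.one_notMem P, by simp⟩
  | succ k ih =>
    rcases ih with ⟨r, hr, v, hv⟩ | ⟨l, hl, h⟩
    · by_cases hvP : v ∈ P
      · obtain ⟨s, hs, w, hw⟩ := hπ v hvP
        refine Or.inl ⟨s * r, ‹P.IsPrime›.mul_notMem hs hr, w, ?_⟩
        rw [mul_assoc, hv, pow_succ, mul_assoc, ← hw]; ring
      · exact Or.inr ⟨k, k.lt_succ_self, r, hr, v, hvP, hv⟩
    · exact Or.inr ⟨l, hl.trans k.lt_succ_self, h⟩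

/-- The elements divisible by all powers of a local generator of a prime form a prime ideal. -/
theorem Ideal.exists_prime_lt_of_locally_dvd {A : Type*} [CommRing A] [IsDomain A] (P : Ideal A)
    [hP : P.IsPrime] {π : A} (hπP : π ∈ P) (hπ0 : π ≠ 0)
    (hπ : ∀ x ∈ P, ∃ s ∉ P, π ∣ s * x) :
    ∃ Q : Ideal A, Q.IsPrime ∧ Q ≤ P ∧ π ∉ Q ∧
      ∀ z, z ∈ Q ↔ ∀ k : ℕ, ∃ s ∉ P, π ^ k ∣ s * z := by
  let Q : Ideal A :=
    { carrier := {z | ∀ k : ℕ, ∃ s ∉ P, π ^ k ∣ s * z}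
      add_mem' := by
        intro a b ha hb k
        obtain ⟨s, hs, hsa⟩ := ha k
        obtain ⟨t, ht, htb⟩ := hb k
        refine ⟨s * t, hP.mul_notMem hs ht, ?_⟩
        have : s * t * (a + b) = t * (s * a) + s * (t * b) := by ring
        rw [this]
        exact dvd_add (hsa.mul_left _) (htb.mul_left _)
      zero_mem' := fun k => ⟨1, Ideal.one_notMem P, by simp⟩
      smul_mem' := by
        intro c a ha k
        obtain ⟨s, hs, hsa⟩ := ha k
        refine ⟨s, hs, ?_⟩
        rw [smul_eq_mul, mul_left_comm]
        exact hsa.mul_left _ }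
  have hQ : ∀ z, z ∈ Q ↔ ∀ k : ℕ, ∃ s ∉ P, π ^ k ∣ s * z := fun z => Iff.rfl
  have hQP : Q ≤ P := by
    intro z hz
    obtain ⟨s, hs, hd⟩ := (hQ z).1 hz 1
    rw [pow_one] at hd
    exact (hP.mem_or_mem (P.mem_of_dvd hd hπP)).resolve_left hs
  refine ⟨Q, ⟨fun h => hP.ne_top (top_le_iff.1 (h ▸ hQP)), ?_⟩, hQP, ?_, hQ⟩
  -- Exact orders `k'` and `l'` of `z` and `w` add up, so `z * w` is not locally divisible by `π ^
  -- (k' + l' + 1)`.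
  · intro z w hzw
    by_contra! hc
    obtain ⟨hz, hw⟩ := hc
    rw [hQ] at hz hw
    push Not at hz hw
    obtain ⟨k, hk⟩ := hz
    obtain ⟨l, hl⟩ := hw
    obtain ⟨k', -, s, hs, u, hu, h1⟩ := (P.exists_pow_dvd_or hπ z k).resolve_left
      (fun ⟨r, hr, h⟩ => hk r hr h)
    obtain ⟨l', -, t, ht, v, hv, h2⟩ := (P.exists_pow_dvd_or hπ w l).resolve_left
      (fun ⟨r, hr, h⟩ => hl r hr h)
    obtain ⟨r, hr, c, hc⟩ := (hQ _).1 hzw (k' + l' + 1)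
    have : r * u * v = π * (c * s * t) := by
      apply mul_left_cancel₀ (pow_ne_zero (k' + l') hπ0)
      linear_combination s * t * hc - r * π ^ l' * v * h1 - r * s * z * h2
    exact hP.mul_notMem (hP.mul_notMem hr hu) hv (this ▸ P.mul_mem_right _ hπP)
  · intro h
    obtain ⟨s, hs, c, hc⟩ := (hQ _).1 h 2
    have : s = π * c := by
      apply mul_right_cancel₀ hπ0
      linear_combination hc
    exact hs (this ▸ P.mul_mem_right _ hπP)

/-- A domain with the factorization property is a Prüfer domain. -/
theorem HasInvRadFactorization.dvdColon_sup_eq_top {A : Type*} [CommRing A]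
    [IsDomain A] (h : HasInvRadFactorization A) (x y : A) :
    Ideal.dvdColon x y ⊔ Ideal.dvdColon y x = ⊤ := by
  by_contra hne
  obtain ⟨M, hM, hFM⟩ := Ideal.exists_le_maximal _ hne
  obtain ⟨P, hP, -⟩ := Ideal.exists_minimalPrimes_le hFM
  have hPp := hP.1.1
  rcases eq_or_ne x 0 with rfl | hx0
  · exact hPp.ne_top ((Ideal.eq_top_iff_one _).2
      (hP.1.2 (Ideal.mem_sup_right (Ideal.mem_dvdColon.2 (by simp)))))
  have hxP : x ∈ P := hP.1.2 (Ideal.mem_sup_left (Ideal.mem_dvdColon.2 (dvd_mul_left _ _)))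
  obtain ⟨π, hπP, hπ⟩ := h.exists_locally_dvd P (by rintro rfl; exact hx0 (by simpa using hxP))
  have hπ0 : π ≠ 0 := by
    rintro rfl
    obtain ⟨s, hs, hd⟩ := hπ x hxP
    rcases mul_eq_zero.1 (zero_dvd_iff.1 hd) with rfl | h0
    exacts [hs (zero_mem _), hx0 h0]
  obtain ⟨Q, hQp, hQP, hπQ, hQ⟩ := P.exists_prime_lt_of_locally_dvd hπP hπ0 hπ
  -- Let `y s = x d` with `s` of exact order `k` at `P`. If `d` has order at least `k`, then `(x :
  -- y)` leaves `P`; otherwise `(y : x)` does. So both colon ideals lie in `Q`, against the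
  -- minimality of `P`.
  have key : ∀ x y : A, Ideal.dvdColon x y ≤ P → Ideal.dvdColon y x ≤ P →
      Ideal.dvdColon x y ≤ Q := by
    intro x y h1 h2 s hs
    by_contra hsQ
    rw [hQ] at hsQ
    push Not at hsQ
    obtain ⟨k₀, hk₀⟩ := hsQ
    obtain ⟨k, -, t, ht, u, hu, htu⟩ := (P.exists_pow_dvd_or hπ s k₀).resolve_left
      (fun ⟨r, hr, h⟩ => hk₀ r hr h)
    obtain ⟨d, hd⟩ := Ideal.mem_dvdColon.1 hs
    rcases P.exists_pow_dvd_or hπ d k with ⟨r, hr, w, hw⟩ | ⟨l, hl, r, hr, v, hv, hrv⟩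
    · refine hPp.mul_notMem hu hr (h1 (Ideal.mem_dvdColon.2 ⟨w * t, ?_⟩))
      apply mul_left_cancel₀ (pow_ne_zero k hπ0)
      linear_combination x * t * hw - y * r * htu + t * r * hd
    · refine hPp.mul_notMem hv ht (h2 (Ideal.mem_dvdColon.2 ⟨π ^ (k - l) * u * r, ?_⟩))
      obtain ⟨e, rfl⟩ := Nat.exists_eq_add_of_le hl.le
      rw [Nat.add_sub_cancel_left]
      apply mul_left_cancel₀ (pow_ne_zero l hπ0)
      linear_combination y * r * htu - x * t * hrv - t * r * hd
  have h1 := le_sup_left.trans hP.1.2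
  have h2 := le_sup_right.trans hP.1.2
  exact hπQ (hP.2 ⟨hQp, sup_le (key x y h1 h2) (key y x h2 h1)⟩ hQP hπP)

theorem HasInvRadFactorization.exists_dvd_or_dvd {A : Type*} [CommRing A]
    [IsDomain A] (h : HasInvRadFactorization A) (P : Ideal A) [hP : P.IsPrime] (x y : A) :
    ∃ s ∉ P, x ∣ y * s ∨ y ∣ x * s := by
  by_contra! hc
  refine hP.ne_top (top_le_iff.1 (h.dvdColon_sup_eq_top x y ▸ sup_le ?_ ?_))
  · intro s hs
    by_contra hsP
    exact (hc s hsP).1 hs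
  · intro s hs
    by_contra hsP
    exact (hc s hsP).2 hs

/-- With `s + t = 1` from the Prüfer property and `c * t = b * d`, the generators are `s` and `d`.
-/
theorem HasInvRadFactorization.dvdColon_fg {A : Type*} [CommRing A]
    [IsDomain A] (h : HasInvRadFactorization A) {c : A} (hc : c ≠ 0) (b : A) :
    (Ideal.dvdColon c b).FG := by
  have h1 := (Ideal.eq_top_iff_one _).1 (h.dvdColon_sup_eq_top c b)
  obtain ⟨s, hs, t, ⟨d, hd⟩, hst⟩ := Submodule.mem_sup.1 h1
  have : Ideal.dvdColon c b = Ideal.span {s, d} := by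
    apply le_antisymm
    · rintro x ⟨z, hz⟩
      rw [Ideal.mem_span_pair]
      refine ⟨x, z, ?_⟩
      apply mul_left_cancel₀ hc
      linear_combination c * x * hst - x * hd - d * hz
    · rw [Ideal.span_le]
      rintro x (rfl | rfl)
      · exact hs
      · exact ⟨t, hd.symm⟩
  rw [this]
  exact Submodule.fg_span (by simp)

/-! ### Divisorial closure without fractions. -/

/-- The divisorial closure of an ideal as an ideal of the ring. -/
def Ideal.divisorialHull {A : Type*} [CommRing A] (I : Ideal A) : Ideal A where
  carrier := {x | ∀ b c : A, c ≠ 0 → (∀ i ∈ I, c ∣ b * i) → c ∣ b * x}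
  add_mem' hx hy b c hc h := by rw [mul_add]; exact dvd_add (hx b c hc h) (hy b c hc h)
  zero_mem' := by simp
  smul_mem' r x hx b c hc h := by
    rw [smul_eq_mul, mul_left_comm]
    exact (hx b c hc h).mul_left r

/-- The elements of `(A : I)` are the fractions `b / c` with `c ∣ b * i` for all `i ∈ I`; since `1`
is one of them, the closure lies in `A`. -/
theorem divisorialClosure_eq_coe_divisorialHull {A : Type*} [CommRing A] [IsDomain A]
    {I : Ideal A} (hI : I ≠ ⊥) :
    divisorialClosure I = (I.divisorialHull : FractionalIdeal A⁰ (FractionRing A)) := by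
  have hI0 : (I : FractionalIdeal A⁰ (FractionRing A)) ≠ 0 := by simpa using hI
  have hmem : ∀ t : FractionRing A, t ∈ 1 / (I : FractionalIdeal A⁰ (FractionRing A)) ↔
      ∀ i ∈ I, ∃ z, algebraMap A (FractionRing A) z = t * algebraMap A (FractionRing A) i := by
    intro t
    rw [FractionalIdeal.mem_div_iff_of_ne_zero hI0]
    simp only [FractionalIdeal.mem_coeIdeal, FractionalIdeal.mem_one_iff]
    constructor
    · exact fun h i hi => h _ ⟨i, hi, rfl⟩
    · rintro h _ ⟨i, hi, rfl⟩
      exact h i hi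
  have h1 : (1 : FractionRing A) ∈ 1 / (I : FractionalIdeal A⁰ (FractionRing A)) :=
    (hmem 1).2 fun i _ => ⟨i, by simp⟩
  have hne : 1 / (I : FractionalIdeal A⁰ (FractionRing A)) ≠ 0 := by
    intro h0
    rw [h0, FractionalIdeal.mem_zero_iff] at h1
    exact one_ne_zero h1
  have hfrac : ∀ b c z i : A, c ≠ 0 →
      (algebraMap A (FractionRing A) z =
        algebraMap A (FractionRing A) b / algebraMap A (FractionRing A) c *
          algebraMap A (FractionRing A) i ↔ b * i = c * z) := by
    intro b c z i hc
    have hc' : algebraMap A (FractionRing A) c ≠ 0 := by simpa using hc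
    rw [div_mul_eq_mul_div, eq_div_iff hc', ← map_mul, ← map_mul,
      (IsFractionRing.injective A (FractionRing A)).eq_iff, mul_comm z, eq_comm]
  ext y
  rw [divisorialClosure, FractionalIdeal.mem_div_iff_of_ne_zero hne]
  simp only [FractionalIdeal.mem_coeIdeal, FractionalIdeal.mem_one_iff]
  constructor
  · intro h
    obtain ⟨x, hx⟩ := h 1 h1
    rw [mul_one] at hx
    subst hx
    refine ⟨x, ?_, rfl⟩
    intro b c hc hbc
    obtain ⟨z, hz⟩ := h (algebraMap A (FractionRing A) b / algebraMap A (FractionRing A) c)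
      ((hmem _).2 fun i hi => by
        obtain ⟨z, hz⟩ := hbc i hi
        exact ⟨z, (hfrac b c z i hc).2 hz⟩)
    rw [mul_comm, hfrac b c z x hc] at hz
    exact ⟨z, hz⟩
  · rintro ⟨x, hx, rfl⟩ t ht
    obtain ⟨b, c, hc, rfl⟩ := IsFractionRing.div_surjective (A := A) t
    have hc0 : c ≠ 0 := nonZeroDivisors.ne_zero hc
    obtain ⟨z, hz⟩ := hx b c hc0 fun i hi => by
      obtain ⟨z, hz⟩ := (hmem _).1 ht i hi
      exact ⟨z, (hfrac b c z i hc0).1 hz⟩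
    exact ⟨z, by rw [mul_comm]; exact (hfrac b c z x hc0).2 hz⟩

theorem HasWeakFactorization.eq_divisorialHull_mul {A : Type*} [CommRing A] [IsDomain A]
    (h : HasWeakFactorization A) {I : Ideal A} (hI : I ≠ ⊥) (hne : I ≠ I.divisorialHull) :
    ∃ M : Multiset (Ideal A), (∀ m ∈ M, m.IsMaximal) ∧ I = I.divisorialHull * M.prod := by
  have hcl := divisorialClosure_eq_coe_divisorialHull hI
  obtain ⟨M, hM, hIM⟩ := h I hI (by
    intro hd
    rw [IsDivisorialIdeal, hcl] at hd
    exact hne (FractionalIdeal.coeIdeal_injective hd))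
  refine ⟨M, hM, ?_⟩
  rw [hcl, ← FractionalIdeal.coeIdeal_mul] at hIM
  exact FractionalIdeal.coeIdeal_injective hIM

/-! ### Almost Dedekind domains: orders, products of radical ideals, isolation. -/

/-- An elementwise form of the almost Dedekind property: nonzero primes are maximal, the ring is
not a field, and the maximal ideals are locally principal. -/
structure IsAlmostDedekind (B : Type*) [CommRing B] : Prop where
  isMaximal : ∀ P : Ideal B, P.IsPrime → P ≠ ⊥ → P.IsMaximal
  ne_bot : ∀ N : Ideal B, N.IsMaximal → N ≠ ⊥
  exists_locally_dvd : ∀ N : Ideal B, N.IsMaximal → ∃ π ∈ N, ∀ x ∈ N, ∃ s ∉ N, π ∣ s * x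

theorem Ideal.mem_of_forall_isMaximal {B : Type*} [CommRing B] {D : Ideal B} {c : B}
    (h : ∀ N : Ideal B, N.IsMaximal → ∃ s ∉ N, s * c ∈ D) : c ∈ D := by
  have : D.colon {c} = ⊤ := by
    by_contra hne
    obtain ⟨N, hN, hle⟩ := Ideal.exists_le_maximal _ hne
    obtain ⟨s, hs, hsc⟩ := h N hN
    exact hs (hle (by simpa [Submodule.mem_colon_singleton] using hsc))
  have h1 := (Ideal.eq_top_iff_one _).1 this
  simpa [Submodule.mem_colon_singleton] using h1

theorem Ideal.eq_top_of_forall_isMaximal {B : Type*} [CommRing B] {D : Ideal B}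
    (h : ∀ N : Ideal B, N.IsMaximal → ∃ s ∉ N, s ∈ D) : D = ⊤ :=
  (Ideal.eq_top_iff_one _).2
    (Ideal.mem_of_forall_isMaximal fun N hN => by simpa using h N hN)

/-- Clears the denominators of finitely many generators at once, spreading an inclusion at `N` to
all maximal ideals avoiding `f`. -/
theorem Ideal.exists_forall_mul_mem_of_fg {B : Type*} [CommRing B] {N : Ideal B} (hN : N.IsPrime)
    {F D : Ideal B} (hF : F.FG) (h : ∀ x ∈ F, ∃ s ∉ N, s * x ∈ D) :
    ∃ f ∉ N, ∀ x ∈ F, f * x ∈ D := by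
  classical
  obtain ⟨T, rfl⟩ := hF
  choose! s hs hsD using h
  refine ⟨∏ x ∈ T, s x, ?_, ?_⟩
  · rw [hN.prod_mem_iff]
    rintro ⟨x, hx, hxN⟩
    exact hs x (Ideal.subset_span hx) hxN
  · intro x hx
    have : Ideal.span (T : Set B) ≤ D.colon {∏ x ∈ T, s x} := by
      rw [Ideal.span_le]
      intro y hy
      rw [SetLike.mem_coe, Submodule.mem_colon_singleton, smul_eq_mul,
        ← Finset.mul_prod_erase T s hy, ← mul_assoc]
      exact Ideal.mul_mem_right _ _ (mul_comm y (s y) ▸ hsD y (Ideal.subset_span hy))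
    have := this hx
    rwa [Submodule.mem_colon_singleton, smul_eq_mul, mul_comm] at this

namespace IsAlmostDedekind

variable {B : Type*} [CommRing B] [IsDomain B]

theorem exists_uniformizer (hB : IsAlmostDedekind B) {N : Ideal B} (hN : N.IsMaximal) :
    ∃ π ∈ N, π ≠ 0 ∧ ∀ x ∈ N, ∃ s ∉ N, π ∣ s * x := by
  obtain ⟨π, hπN, hπ⟩ := hB.exists_locally_dvd N hN
  refine ⟨π, hπN, ?_, hπ⟩
  rintro rfl
  obtain ⟨x, hx, hx0⟩ := Submodule.exists_mem_ne_zero_of_ne_bot (hB.ne_bot N hN)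
  obtain ⟨s, hs, hd⟩ := hπ x hx
  rcases mul_eq_zero.1 (zero_dvd_iff.1 hd) with rfl | h0
  exacts [hs (zero_mem _), hx0 h0]

omit [IsDomain B] in
theorem mem_pow_of_mul_mem {N : Ideal B} (hN : N.IsMaximal) {s c : B} {k : ℕ} (hs : s ∉ N)
    (h : s * c ∈ N ^ k) : c ∈ N ^ k := by
  rcases Nat.eq_zero_or_pos k with rfl | hk
  · simp
  · have hprim : (N ^ k).IsPrimary := Ideal.isPrimary_of_isMaximal_radical (by
      rwa [Ideal.radical_pow _ hk.ne', hN.isPrime.isRadical.radical])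
    have := (Ideal.isPrimary_iff.1 hprim).2 ((mul_comm s c) ▸ h)
    refine this.resolve_right fun h' => hs ?_
    rwa [Ideal.radical_pow _ hk.ne', hN.isPrime.isRadical.radical] at h'

omit [IsDomain B] in
theorem exists_pow_dvd_of_mem_pow {N : Ideal B} (hN : N.IsMaximal) {π : B}
    (hπ : ∀ x ∈ N, ∃ s ∉ N, π ∣ s * x) {c : B} {k : ℕ} (hc : c ∈ N ^ k) :
    ∃ s ∉ N, π ^ k ∣ s * c := by
  induction k generalizing c with
  | zero => exact ⟨1, Ideal.one_notMem N, by simp⟩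
  | succ k ih =>
    rw [pow_succ] at hc
    induction hc using Submodule.mul_induction_on' with
    | mem_mul_mem x hx y hy =>
      obtain ⟨s, hs, h1⟩ := ih hx
      obtain ⟨t, ht, h2⟩ := hπ y hy
      refine ⟨s * t, hN.isPrime.mul_notMem hs ht, ?_⟩
      rw [pow_succ, mul_mul_mul_comm]
      exact mul_dvd_mul h1 h2
    | add x hx y hy h1 h2 =>
      obtain ⟨s, hs, h1⟩ := h1
      obtain ⟨t, ht, h2⟩ := h2
      refine ⟨s * t, hN.isPrime.mul_notMem hs ht, ?_⟩
      have : s * t * (x + y) = t * (s * x) + s * (t * y) := by ring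
      rw [this]
      exact dvd_add (h1.mul_left _) (h2.mul_left _)

omit [IsDomain B] in
theorem exists_mul_eq_of_notMem_pow {N : Ideal B} (hN : N.IsMaximal) {π : B} (hπN : π ∈ N)
    (hπ : ∀ x ∈ N, ∃ s ∉ N, π ∣ s * x) {c : B} {e : ℕ} (hc : c ∉ N ^ (e + 1)) :
    ∃ l ≤ e, ∃ r ∉ N, ∃ v ∉ N, r * c = π ^ l * v := by
  have := hN.isPrime
  rcases N.exists_pow_dvd_or hπ c (e + 1) with ⟨r, hr, hd⟩ | ⟨l, hl, h⟩
  · exact absurd (mem_pow_of_mul_mem hN hr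
      (Ideal.mem_of_dvd _ hd (Ideal.pow_mem_pow hπN _))) hc
  · exact ⟨l, Nat.lt_succ_iff.1 hl, h⟩

/-- The order of `d` at `N` is at most `e`, that of `c` at least `e`. -/
theorem exists_dvd_mul (hB : IsAlmostDedekind B) {N : Ideal B} (hN : N.IsMaximal) {c d : B} {e : ℕ}
    (hd : d ∉ N ^ (e + 1)) (hc : c ∈ N ^ e) : ∃ s ∉ N, d ∣ s * c := by
  obtain ⟨π, hπN, -, hπ⟩ := hB.exists_uniformizer hN
  obtain ⟨l, hl, r, hr, v, hv, h1⟩ := exists_mul_eq_of_notMem_pow hN hπN hπ hd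
  obtain ⟨s, hs, w, h2⟩ := exists_pow_dvd_of_mem_pow hN hπ hc
  obtain ⟨m, rfl⟩ := Nat.exists_eq_add_of_le hl
  refine ⟨v * s, hN.isPrime.mul_notMem hv hs, π ^ m * w * r, ?_⟩
  linear_combination v * h2 - π ^ m * w * h1

/-- Elements of all powers of `N` lie in a prime strictly below `N`, which must be zero. -/
theorem exists_notMem_pow (hB : IsAlmostDedekind B) {N : Ideal B} (hN : N.IsMaximal) {c : B}
    (hc : c ≠ 0) : ∃ e, c ∉ N ^ e := by
  have := hN.isPrime
  obtain ⟨π, hπN, hπ0, hπ⟩ := hB.exists_uniformizer hN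
  obtain ⟨Q, hQp, hQN, hπQ, hQ⟩ := N.exists_prime_lt_of_locally_dvd hπN hπ0 hπ
  by_contra! hall
  have hcQ : c ∈ Q := (hQ c).2 fun k => exists_pow_dvd_of_mem_pow hN hπ (hall k)
  have hQmax := hB.isMaximal Q hQp (by rintro rfl; exact hc (by simpa using hcQ))
  exact hπQ (hQmax.eq_of_le hN.ne_top hQN ▸ hπN)

theorem mul_notMem_pow (hB : IsAlmostDedekind B) {N : Ideal B} (hN : N.IsMaximal) {c d : B}
    {e f : ℕ} (hc : c ∉ N ^ (e + 1)) (hd : d ∉ N ^ (f + 1)) : c * d ∉ N ^ (e + f + 1) := by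
  obtain ⟨π, hπN, hπ0, hπ⟩ := hB.exists_uniformizer hN
  obtain ⟨l, hl, r, hr, v, hv, h1⟩ := exists_mul_eq_of_notMem_pow hN hπN hπ hc
  obtain ⟨m, hm, r', hr', v', hv', h2⟩ := exists_mul_eq_of_notMem_pow hN hπN hπ hd
  intro hmem
  obtain ⟨t, ht, w, hw⟩ := exists_pow_dvd_of_mem_pow hN hπ
    (Ideal.pow_le_pow_right (show l + m + 1 ≤ e + f + 1 by omega) hmem)
  have : t * v * v' = π * (r * r' * w) := by
    apply mul_left_cancel₀ (pow_ne_zero (l + m) hπ0)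
    linear_combination r * r' * hw - t * π ^ m * v' * h1 - t * r * c * h2
  exact hN.isPrime.mul_notMem (hN.isPrime.mul_notMem ht hv) hv' (this ▸ N.mul_mem_right _ hπN)

theorem exists_notMem_sq (hB : IsAlmostDedekind B) {N : Ideal B} (hN : N.IsMaximal) :
    ∃ π ∈ N, π ∉ N ^ 2 := by
  obtain ⟨π, hπN, hπ0, hπ⟩ := hB.exists_uniformizer hN
  refine ⟨π, hπN, fun hmem => ?_⟩
  obtain ⟨t, ht, w, hw⟩ := exists_pow_dvd_of_mem_pow hN hπ hmem
  have : t = π * w := by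
    apply mul_right_cancel₀ hπ0
    linear_combination hw
  exact ht (this ▸ N.mul_mem_right _ hπN)

theorem exists_order (hB : IsAlmostDedekind B) {N : Ideal B} (hN : N.IsMaximal) {C : Ideal B}
    (hC : C ≠ ⊥) : ∃ e, C ≤ N ^ e ∧ ¬ C ≤ N ^ (e + 1) := by
  classical
  have hex : ∃ e, ¬ C ≤ N ^ e := by
    obtain ⟨c, hc, hc0⟩ := Submodule.exists_mem_ne_zero_of_ne_bot hC
    obtain ⟨e, he⟩ := hB.exists_notMem_pow hN hc0
    exact ⟨e, fun h => he (h hc)⟩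
  have h0 : Nat.find hex ≠ 0 := by
    intro h
    have := Nat.find_spec hex
    rw [h] at this
    simp at this
  obtain ⟨e, he⟩ := Nat.exists_eq_succ_of_ne_zero h0
  refine ⟨e, not_not.1 (Nat.find_min hex (by omega)), ?_⟩
  have := Nat.find_spec hex
  rwa [he] at this

theorem not_mul_le_pow (hB : IsAlmostDedekind B) {N : Ideal B} (hN : N.IsMaximal) {C D : Ideal B}
    {e f : ℕ} (hC : ¬ C ≤ N ^ (e + 1)) (hD : ¬ D ≤ N ^ (f + 1)) :
    ¬ C * D ≤ N ^ (e + f + 1) := by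
  obtain ⟨c, hc, hc'⟩ := SetLike.not_le_iff_exists.1 hC
  obtain ⟨d, hd, hd'⟩ := SetLike.not_le_iff_exists.1 hD
  exact fun h => hB.mul_notMem_pow hN hc' hd' (h (Ideal.mul_mem_mul hc hd))

theorem not_pow_le_pow (hB : IsAlmostDedekind B) {N : Ideal B} (hN : N.IsMaximal) {E : Ideal B}
    (hE : ¬ E ≤ N ^ 2) (j : ℕ) : ¬ E ^ j ≤ N ^ (j + 1) := by
  induction j with
  | zero =>
    simp only [pow_zero, zero_add, pow_one, Ideal.one_eq_top, top_le_iff]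
    exact hN.ne_top
  | succ j ih =>
    rw [pow_succ]
    exact hB.not_mul_le_pow hN ih hE

/-- An element of `Q` of order at most `e` divides some `s * π ^ e` with `s ∉ N`, so `Q` contains a
power of `s * π`, hence `s * π`, which has order one. -/
theorem _root_.Ideal.IsRadical.not_le_sq (hB : IsAlmostDedekind B) {N : Ideal B}
    (hN : N.IsMaximal) {Q : Ideal B} (hQ : Q.IsRadical) (h0 : Q ≠ ⊥) : ¬ Q ≤ N ^ 2 := by
  intro hle
  obtain ⟨π, hπN, hπ2⟩ := hB.exists_notMem_sq hN
  obtain ⟨e, -, he⟩ := hB.exists_order hN h0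
  obtain ⟨q, hqQ, hq⟩ := SetLike.not_le_iff_exists.1 he
  obtain ⟨s, hs, t, ht⟩ := hB.exists_dvd_mul hN hq (Ideal.pow_mem_pow hπN e)
  have h1 : s * π ∈ Q := by
    refine hQ ⟨e + 1, ?_⟩
    have : (s * π) ^ (e + 1) = q * (t * s ^ e * π) := by
      calc (s * π) ^ (e + 1) = (s * π ^ e) * (s ^ e * π) := by ring
        _ = _ := by rw [ht]; ring
    rw [this]
    exact Q.mul_mem_right _ hqQ
  exact hπ2 (mem_pow_of_mul_mem hN hs (hle h1))

theorem le_of_forall_order (hB : IsAlmostDedekind B) {C D : Ideal B}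
    (h : ∀ N : Ideal B, N.IsMaximal → ∃ e, C ≤ N ^ e ∧ ¬ D ≤ N ^ (e + 1)) : C ≤ D := by
  intro c hc
  refine Ideal.mem_of_forall_isMaximal fun N hN => ?_
  obtain ⟨e, hCe, hDe⟩ := h N hN
  obtain ⟨d, hd, hd'⟩ := SetLike.not_le_iff_exists.1 hDe
  obtain ⟨s, hs, hdvd⟩ := hB.exists_dvd_mul hN hd' (hCe hc)
  exact ⟨s, hs, D.mem_of_dvd hdvd hd⟩

/-- If no maximal ideal is critical, then being outside the `k`-th power of a maximal ideal is
an open condition. -/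
theorem exists_forall_not_le_pow (hB : IsAlmostDedekind B)
    (hnc : ∀ N : Ideal B, N.IsMaximal → ∃ E : Ideal B, E.FG ∧ E ≤ N ∧
      ∀ N' : Ideal B, N'.IsMaximal → ¬ E ≤ N' ^ 2)
    {N : Ideal B} (hN : N.IsMaximal) {C : Ideal B} {k : ℕ} (hC : ¬ C ≤ N ^ k) :
    ∃ f ∉ N, ∀ N' : Ideal B, N'.IsMaximal → f ∉ N' → ¬ C ≤ N' ^ k := by
  obtain ⟨c, hcC, hc⟩ := SetLike.not_le_iff_exists.1 hC
  have hc0 : Ideal.span {c} ≠ ⊥ := by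
    rw [Ne, Ideal.span_singleton_eq_bot]
    rintro rfl
    exact hc (zero_mem _)
  obtain ⟨j, hj, hj'⟩ := hB.exists_order hN hc0
  rw [Ideal.span_singleton_le_iff_mem] at hj hj'
  have hjk : j + 1 ≤ k := by
    by_contra! hlt
    exact hc (Ideal.pow_le_pow_right (by omega) hj)
  -- Near `N` one has `f * E ^ j ⊆ (c)`. As `E` has order at most one everywhere, `c` has order at
  -- most `j` wherever `f` is a unit.
  obtain ⟨E, hE, hEN, hE2⟩ := hnc N hN
  obtain ⟨f, hf, hfE⟩ := Ideal.exists_forall_mul_mem_of_fg hN.isPrime (D := Ideal.span {c})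
    (hE.pow (n := j)) (by
      intro x hx
      obtain ⟨s, hs, hd⟩ := hB.exists_dvd_mul hN hj' (Ideal.pow_right_mono hEN j hx)
      exact ⟨s, hs, Ideal.mem_span_singleton.2 hd⟩)
  refine ⟨f, hf, fun N' hN' hfN' hle => ?_⟩
  have h1 := hB.not_mul_le_pow hN' (C := Ideal.span {f}) (e := 0)
    (by simpa [Ideal.span_singleton_le_iff_mem] using hfN') (hB.not_pow_le_pow hN' (hE2 N' hN') j)
  refine h1 ?_
  rw [Ideal.span_singleton_mul_le_iff]
  intro x hx
  rw [zero_add]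
  exact Ideal.pow_le_pow_right hjk
    ((Ideal.span_singleton_le_iff_mem _).2 (hle hcC) (hfE x hx))

/-- Local bounds on the order become global by quasi-compactness. -/
theorem exists_forall_not_le_pow_succ (hB : IsAlmostDedekind B)
    (hnc : ∀ N : Ideal B, N.IsMaximal → ∃ E : Ideal B, E.FG ∧ E ≤ N ∧
      ∀ N' : Ideal B, N'.IsMaximal → ¬ E ≤ N' ^ 2) {C : Ideal B} (hC : C ≠ ⊥) :
    ∃ m, ∀ N : Ideal B, N.IsMaximal → ¬ C ≤ N ^ m := by
  classical
  let T : Set B := {f | ∃ k, ∀ N : Ideal B, N.IsMaximal → f ∉ N → ¬ C ≤ N ^ k}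
  have hT : Ideal.span T = ⊤ := by
    refine Ideal.eq_top_of_forall_isMaximal fun N hN => ?_
    obtain ⟨e, -, he⟩ := hB.exists_order hN hC
    obtain ⟨f, hf, hfN⟩ := hB.exists_forall_not_le_pow hnc hN he
    exact ⟨f, hf, Ideal.subset_span ⟨_, hfN⟩⟩
  obtain ⟨T', hT', hspan⟩ := (Ideal.span_eq_top_iff_finite T).1 hT
  choose! k hk using hT'
  refine ⟨T'.sup k, fun N hN hle => hN.ne_top (top_le_iff.1 (hspan ▸ Ideal.span_le.2 ?_))⟩
  intro f hf
  by_contra hfN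
  exact hk hf N hN hfN (hle.trans (Ideal.pow_le_pow_right (Finset.le_sup hf)))

/-- An almost Dedekind domain without critical maximal ideals is an SP-domain. -/
theorem isSPDomain (hB : IsAlmostDedekind B)
    (hnc : ∀ N : Ideal B, N.IsMaximal → ∃ E : Ideal B, E.FG ∧ E ≤ N ∧
      ∀ N' : Ideal B, N'.IsMaximal → ¬ E ≤ N' ^ 2) : IsSPDomain B := by
  classical
  intro C
  rcases eq_or_ne C ⊥ with rfl | hC
  · exact ⟨{⊥}, by simpa using Ideal.isRadical_bot, by simp⟩
  obtain ⟨m, hm⟩ := hB.exists_forall_not_le_pow_succ hnc hC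
  let Q : ℕ → Ideal B := fun k => sInf {N : Ideal B | N.IsMaximal ∧ C ≤ N ^ (k + 1)}
  have hQrad : ∀ k, (Q k).IsRadical := fun k r ⟨n, hr⟩ => by
    rw [Submodule.mem_sInf] at hr ⊢
    exact fun N hN => hN.1.isPrime.mem_of_pow_mem n (hr N hN)
  -- The locus where `C` has order greater than `k` is closed, so the intersection `Q k` acquires no
  -- further maximal overideals.
  have hQ : ∀ k N, N.IsMaximal → (Q k ≤ N ↔ C ≤ N ^ (k + 1)) := by
    refine fun k N hN => ⟨fun hle => ?_, fun hle => sInf_le ⟨hN, hle⟩⟩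
    by_contra hCN
    obtain ⟨f, hf, hfN⟩ := hB.exists_forall_not_le_pow hnc hN hCN
    refine hf (hle (Submodule.mem_sInf.2 fun N' hN' => ?_))
    by_contra hfN'
    exact hfN N' hN'.1 hfN' hN'.2
  have hQ0 : ∀ k, Q k ≠ ⊥ := fun k hk => hC <| le_bot_iff.1 <| hk ▸ le_sInf fun N hN =>
    hN.2.trans (Ideal.pow_le_self k.succ_ne_zero)
  -- At `N` the radical ideal `Q k` has order one for `k < e` and zero otherwise.
  have hprod : ∀ N : Ideal B, N.IsMaximal → ∀ e, C ≤ N ^ e → ¬ C ≤ N ^ (e + 1) → ∀ n,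
      ∏ k ∈ Finset.range n, Q k ≤ N ^ min n e ∧
        ¬ ∏ k ∈ Finset.range n, Q k ≤ N ^ (min n e + 1) := by
    intro N hN e he he' n
    induction n with
    | zero => simpa using hN.ne_top
    | succ n ih =>
      rw [Finset.prod_range_succ]
      rcases lt_or_ge n e with hne | hne
      · have h1 : Q n ≤ N := (hQ n N hN).2 (he.trans (Ideal.pow_le_pow_right hne))
        have h2 := (hQrad n).not_le_sq hB hN (hQ0 n)
        rw [min_eq_left hne.le] at ih
        rw [min_eq_left (Nat.succ_le_of_lt hne)]
        exact ⟨pow_succ N n ▸ Ideal.mul_mono ih.1 h1, hB.not_mul_le_pow hN ih.2 h2⟩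
      · have h1 : ¬ Q n ≤ N ^ (0 + 1) := by
          rw [zero_add, pow_one, hQ n N hN]
          exact fun h => he' (h.trans (Ideal.pow_le_pow_right (by omega)))
        rw [min_eq_right hne] at ih
        rw [min_eq_right (hne.trans n.le_succ)]
        have h2 := hB.not_mul_le_pow hN ih.2 h1
        rw [add_zero] at h2
        exact ⟨Ideal.mul_le_left.trans ih.1, h2⟩
  refine ⟨(Finset.range m).val.map Q, ?_, ?_⟩
  · intro q hq
    obtain ⟨k, -, rfl⟩ := Multiset.mem_map.1 hq
    exact hQrad k
  · change C = ∏ k ∈ Finset.range m, Q k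
    have hmin : ∀ N : Ideal B, N.IsMaximal → ∀ e, C ≤ N ^ e → min m e = e := by
        intro N hN e he
        refine min_eq_right (not_lt.1 fun hlt => hm N hN ?_)
        exact he.trans (Ideal.pow_le_pow_right hlt.le)
    refine le_antisymm (hB.le_of_forall_order fun N hN => ?_)
      (hB.le_of_forall_order fun N hN => ?_)
    all_goals
      obtain ⟨e, he, he'⟩ := hB.exists_order hN hC
      have := hprod N hN e he he' m
      rw [hmin N hN e he] at this
    · exact ⟨e, he, this.2⟩
    · exact ⟨e, this.1, he'⟩

/-- A nonzero ideal, all of whose maximal overideals are isolated by finitely generated ideals, is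
contained in only finitely many maximal ideals. -/
theorem finite_of_forall_isolated (hB : IsAlmostDedekind B) {E : Ideal B} (hE : E ≠ ⊥)
    (h : ∀ N : Ideal B, N.IsMaximal → E ≤ N → ∃ F : Ideal B, F.FG ∧ F ≤ N ∧
      ∀ N' : Ideal B, N'.IsMaximal → F ≤ N' → N' = N) :
    {N : Ideal B | N.IsMaximal ∧ E ≤ N}.Finite := by
  classical
  -- Finitely many elements of `T` generate the unit ideal, every maximal ideal avoids one of them,
  -- and each is avoided by at most one maximal ideal over `E`.
  let T : Set B := {f | {N : Ideal B | N.IsMaximal ∧ E ≤ N ∧ f ∉ N}.Subsingleton}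
  have hT : Ideal.span T = ⊤ := by
    refine Ideal.eq_top_of_forall_isMaximal fun N hN => ?_
    by_cases hEN : E ≤ N
    · obtain ⟨F, hF, hFN, hFiso⟩ := h N hN hEN
      obtain ⟨e, -, he⟩ := hB.exists_order hN hE
      obtain ⟨d, hdE, hd⟩ := SetLike.not_le_iff_exists.1 he
      obtain ⟨f, hf, hfE⟩ := Ideal.exists_forall_mul_mem_of_fg hN.isPrime (D := E)
        (hF.pow (n := e)) (by
          intro x hx
          obtain ⟨s, hs, hdvd⟩ := hB.exists_dvd_mul hN hd (Ideal.pow_right_mono hFN e hx)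
          exact ⟨s, hs, E.mem_of_dvd hdvd hdE⟩)
      refine ⟨f, hf, Ideal.subset_span ?_⟩
      have : ∀ N' : Ideal B, N'.IsMaximal ∧ E ≤ N' ∧ f ∉ N' → N' = N := by
        rintro N' ⟨hN', hEN', hfN'⟩
        refine hFiso N' hN' (hN'.isPrime.le_of_pow_le (n := e) fun x hx => ?_)
        exact (hN'.isPrime.mem_or_mem (hEN' (hfE x hx))).resolve_left hfN'
      exact fun N₁ h₁ N₂ h₂ => (this N₁ h₁).trans (this N₂ h₂).symm
    · obtain ⟨f, hfE, hf⟩ := SetLike.not_le_iff_exists.1 hEN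
      exact ⟨f, hf, Ideal.subset_span fun N₁ h₁ => absurd (h₁.2.1 hfE) h₁.2.2⟩
  obtain ⟨T', hT', hspan⟩ := (Ideal.span_eq_top_iff_finite T).1 hT
  refine (T'.finite_toSet.biUnion (t := fun f => {N : Ideal B | N.IsMaximal ∧ E ≤ N ∧ f ∉ N})
    fun f hf => (hT' hf).finite).subset ?_
  rintro N ⟨hN, hEN⟩
  have : ∃ f ∈ T', f ∉ N := by
    by_contra! hall
    exact hN.ne_top (top_le_iff.1 (hspan ▸ Ideal.span_le.2 hall))
  obtain ⟨f, hf, hfN⟩ := this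
  exact Set.mem_biUnion hf ⟨hN, hEN, hfN⟩

end IsAlmostDedekind

/-! ### Overrings. -/

/-- `B` is a ring between the domain `A` and its quotient field. -/
structure IsOverring (A B : Type*) [CommRing A] [CommRing B] [Algebra A B] : Prop where
  injective : Function.Injective (algebraMap A B)
  exists_mul_eq : ∀ b : B, ∃ x y : A, y ≠ 0 ∧ algebraMap A B y * b = algebraMap A B x

/-- An ideal of a domain that divides a nonzero principal ideal is finitely generated. -/
theorem Ideal.fg_of_mul_eq_span {A : Type*} [CommRing A] [IsDomain A] {J J' : Ideal A} {a : A}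
    (ha : a ≠ 0) (h : J * J' = Ideal.span {a}) : J.FG := by
  have key : ∀ z ∈ J * J', ∃ J₀ : Ideal A, J₀.FG ∧ J₀ ≤ J ∧ z ∈ J₀ * J' := by
    intro z hz
    induction hz using Submodule.mul_induction_on' with
    | mem_mul_mem x hx y hy =>
      exact ⟨Ideal.span {x}, Submodule.fg_span_singleton x,
        (Ideal.span_singleton_le_iff_mem _).2 hx,
        Ideal.mul_mem_mul (Ideal.mem_span_singleton_self x) hy⟩
    | add x hx y hy h1 h2 =>
      obtain ⟨J₁, hf₁, hl₁, h1⟩ := h1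
      obtain ⟨J₂, hf₂, hl₂, h2⟩ := h2
      exact ⟨J₁ ⊔ J₂, Submodule.FG.sup hf₁ hf₂, sup_le hl₁ hl₂, add_mem (Ideal.mul_mono_left le_sup_left h1)
        (Ideal.mul_mono_left le_sup_right h2)⟩
  obtain ⟨J₀, hfg, hle, hmem⟩ := key a (h ▸ Ideal.mem_span_singleton_self a)
  have : Ideal.span {a} * J ≤ Ideal.span {a} * J₀ := by
    calc Ideal.span {a} * J ≤ (J₀ * J') * J :=
          Ideal.mul_mono_left ((Ideal.span_singleton_le_iff_mem _).2 hmem)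
      _ = Ideal.span {a} * J₀ := by rw [← h]; ring
  rwa [← le_antisymm hle ((Ideal.span_singleton_mul_right_mono ha).1 this)]

namespace HasInvRadFactorization

variable {A B : Type*} [CommRing A] [IsDomain A] [CommRing B] [IsDomain B] [Algebra A B]

omit [IsDomain B] [CommRing B] [Algebra A B] in
theorem exists_mul_eq_mul_of_le (h : HasInvRadFactorization A) {P M : Ideal A} (hP : P.IsPrime)
    (hM : M.IsPrime) (hPM : P ≤ M) {x r : A} (hx : x ∈ P) (hr : r ∉ P) :
    ∃ u ∉ M, ∃ d ∈ P, x * u = r * d := by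
  obtain ⟨u, hu, ⟨d, hd⟩ | ⟨d, hd⟩⟩ := h.exists_dvd_or_dvd M r x
  · exact ⟨u, hu, d, (hP.mem_or_mem (hd ▸ P.mul_mem_right u hx)).resolve_left hr, hd⟩
  · exact absurd (hd ▸ P.mul_mem_right d hx) (hP.mul_notMem hr fun hu' => hu (hPM hu'))

/-- Write `b = x / y`. In the valuation ring of `A` at the contraction of `N`, either `y` divides
`x`, or `x` divides `y` with a quotient `d` outside `N`, because `d * b` is outside `N`. -/
theorem exists_mul_mem_range (h : HasInvRadFactorization A) (ho : IsOverring A B) {N : Ideal B}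
    (hN : N.IsPrime) (b : B) :
    ∃ s x : A, algebraMap A B s ∉ N ∧ algebraMap A B s * b = algebraMap A B x := by
  obtain ⟨x, y, hy, hyb⟩ := ho.exists_mul_eq b
  have hy' : algebraMap A B y ≠ 0 := (map_ne_zero_iff _ ho.injective).2 hy
  obtain ⟨s, hs, ⟨d, hd⟩ | ⟨d, hd⟩⟩ := h.exists_dvd_or_dvd (N.comap (algebraMap A B)) y x
  · refine ⟨s, d, hs, mul_left_cancel₀ hy' ?_⟩
    have := congrArg (algebraMap A B) hd
    rw [map_mul, map_mul] at this
    linear_combination this + algebraMap A B s * hyb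
  · have hd' := congrArg (algebraMap A B) hd
    rw [map_mul, map_mul] at hd'
    have hs' : algebraMap A B d * b = algebraMap A B s := by
      apply mul_left_cancel₀ hy'
      linear_combination algebraMap A B d * hyb - hd'
    exact ⟨d, s, fun hdN => hs (show algebraMap A B s ∈ N from hs' ▸ N.mul_mem_right b hdN), hs'⟩

theorem le_of_comap_le (h : HasInvRadFactorization A) (ho : IsOverring A B) {N N' : Ideal B}
    (hN' : N'.IsPrime) (hle : N.comap (algebraMap A B) ≤ N'.comap (algebraMap A B)) : N ≤ N' := by
  intro b hb
  obtain ⟨s, x, hs, hsb⟩ := h.exists_mul_mem_range ho hN' b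
  have hx : algebraMap A B x ∈ N' := hle (show algebraMap A B x ∈ N from hsb ▸ N.mul_mem_left _ hb)
  exact (hN'.mem_or_mem (hsb ▸ hx)).resolve_left hs

theorem map_comap_eq (h : HasInvRadFactorization A) (ho : IsOverring A B) (C : Ideal B) :
    (C.comap (algebraMap A B)).map (algebraMap A B) = C := by
  refine le_antisymm Ideal.map_comap_le fun c hc => Ideal.mem_of_forall_isMaximal fun N hN => ?_
  obtain ⟨s, x, hs, hsc⟩ := h.exists_mul_mem_range ho hN.isPrime c
  refine ⟨_, hs, hsc ▸ Ideal.mem_map_of_mem _ ?_⟩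
  change algebraMap A B x ∈ C
  exact hsc ▸ C.mul_mem_left _ hc

theorem exists_mul_eq_of_mem_map (h : HasInvRadFactorization A) (ho : IsOverring A B)
    {N : Ideal B} (hN : N.IsPrime) {q : Ideal A} {z : B} (hz : z ∈ q.map (algebraMap A B)) :
    ∃ s, algebraMap A B s ∉ N ∧ ∃ w ∈ q, algebraMap A B s * z = algebraMap A B w := by
  induction hz using Submodule.span_induction with
  | mem z hz =>
    obtain ⟨w, hw, rfl⟩ := hz
    exact ⟨1, by simpa using hN.one_notMem, w, hw, by simp⟩
  | zero => exact ⟨1, by simpa using hN.one_notMem, 0, zero_mem _, by simp⟩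
  | add x y _ _ h1 h2 =>
    obtain ⟨s, hs, w, hw, hsw⟩ := h1
    obtain ⟨t, ht, v, hv, htv⟩ := h2
    refine ⟨s * t, by rw [map_mul]; exact hN.mul_notMem hs ht, t * w + s * v,
      add_mem (q.mul_mem_left _ hw) (q.mul_mem_left _ hv), ?_⟩
    simp only [map_mul, map_add]
    linear_combination algebraMap A B t * hsw + algebraMap A B s * htv
  | smul b x _ h1 =>
    obtain ⟨s, hs, w, hw, hsw⟩ := h1
    obtain ⟨t, y, ht, hty⟩ := h.exists_mul_mem_range ho hN b
    refine ⟨t * s, by rw [map_mul]; exact hN.mul_notMem ht hs, y * w, q.mul_mem_left _ hw, ?_⟩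
    simp only [map_mul, smul_eq_mul]
    linear_combination algebraMap A B s * x * hty + algebraMap A B y * hsw

theorem isRadical_map (h : HasInvRadFactorization A) (ho : IsOverring A B) {q : Ideal A}
    (hq : q.IsRadical) : (q.map (algebraMap A B)).IsRadical := by
  rw [Ideal.isRadical_iff_pow_one_lt 2 one_lt_two]
  intro x hx
  refine Ideal.mem_of_forall_isMaximal fun N hN => ?_
  obtain ⟨s, y, hs, hsx⟩ := h.exists_mul_mem_range ho hN.isPrime x
  have hy2 : algebraMap A B (y ^ 2) ∈ q.map (algebraMap A B) := by
    rw [map_pow, ← hsx, mul_pow]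
    exact Ideal.mul_mem_left _ _ hx
  obtain ⟨t, ht, w, hw, htw⟩ := h.exists_mul_eq_of_mem_map ho hN.isPrime hy2
  rw [← map_mul] at htw
  have hty : t * y ∈ q := by
    refine hq ⟨2, ?_⟩
    have : (t * y) ^ 2 = t * w := by rw [← ho.injective htw]; ring
    rw [this]
    exact q.mul_mem_left _ hw
  refine ⟨algebraMap A B t * algebraMap A B s, hN.isPrime.mul_notMem ht hs, ?_⟩
  rw [mul_assoc, hsx, ← map_mul]
  exact Ideal.mem_map_of_mem _ hty

omit [IsDomain A] in
theorem comap_ne_bot (ho : IsOverring A B) {C : Ideal B} (hC : C ≠ ⊥) :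
    C.comap (algebraMap A B) ≠ ⊥ := by
  obtain ⟨c, hc, hc0⟩ := Submodule.exists_mem_ne_zero_of_ne_bot hC
  obtain ⟨x, y, hy, hyc⟩ := ho.exists_mul_eq c
  intro hb
  have hx : x ∈ C.comap (algebraMap A B) := by
    change algebraMap A B x ∈ C
    exact hyc ▸ C.mul_mem_left _ hc
  rw [hb, Ideal.mem_bot] at hx
  rw [hx, map_zero] at hyc
  exact mul_ne_zero ((map_ne_zero_iff _ ho.injective).2 hy) hc0 hyc

/-- Nonzero ideals of an overring are products of a finitely generated ideal and of radical
ideals. -/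
theorem exists_eq_mul_prod (h : HasInvRadFactorization A) (ho : IsOverring A B) {C : Ideal B}
    (hC : C ≠ ⊥) : ∃ (J : Ideal B) (Q : Multiset (Ideal B)),
      J.FG ∧ (∀ q ∈ Q, q.IsRadical) ∧ C = J * Q.prod := by
  by_cases hC1 : C = ⊤
  · exact ⟨⊤, 0, (Ideal.fg_top B), by simp, by simpa using hC1⟩
  obtain ⟨J, J', a, Q, ha, hJ, -, hQ, hI⟩ := h (C.comap (algebraMap A B)) (comap_ne_bot ho hC)
    (by rwa [Ne, Ideal.comap_eq_top_iff])
  refine ⟨J.map (algebraMap A B), Q.map (Ideal.map (algebraMap A B)),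
    (Ideal.fg_of_mul_eq_span ha hJ).map _, ?_, ?_⟩
  · intro q hq
    obtain ⟨q', hq', rfl⟩ := Multiset.mem_map.1 hq
    exact h.isRadical_map ho (hQ q' hq').2
  · have hmapQ : (Q.prod).map (algebraMap A B) = (Q.map (Ideal.map (algebraMap A B))).prod :=
      map_multiset_prod (Ideal.mapHom (algebraMap A B)) Q
    rw [← h.map_comap_eq ho C, hI, Ideal.map_mul, hmapQ]

theorem isAlmostDedekind (h : HasInvRadFactorization A) (ho : IsOverring A B)
    (hdim : ∀ P : Ideal B, P.IsPrime → P ≠ ⊥ → P.IsMaximal) (hB : ¬ IsField B) :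
    IsAlmostDedekind B where
  isMaximal := hdim
  ne_bot := fun N hN => Ring.ne_bot_of_isMaximal_of_not_isField hN hB
  exists_locally_dvd := by
    intro N hN
    have hNp := hN.isPrime
    obtain ⟨π, hπN, hπ⟩ := h.exists_locally_dvd (N.comap (algebraMap A B))
      (comap_ne_bot ho (Ring.ne_bot_of_isMaximal_of_not_isField hN hB))
    refine ⟨algebraMap A B π, hπN, fun x hx => ?_⟩
    obtain ⟨s, y, hs, hsx⟩ := h.exists_mul_mem_range ho hNp x
    obtain ⟨t, ht, w, hw⟩ := hπ y (show algebraMap A B y ∈ N from hsx ▸ N.mul_mem_left _ hx)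
    refine ⟨algebraMap A B t * algebraMap A B s, hNp.mul_notMem ht hs, algebraMap A B w, ?_⟩
    rw [mul_assoc, hsx, ← map_mul, hw, map_mul]

/-- A high power of `u` has order at least that of `a`; the multipliers are then moved into `A`. -/
theorem exists_mul_pow_eq (h : HasInvRadFactorization A) (ho : IsOverring A B)
    (hB : IsAlmostDedekind B) {N : Ideal B} (hN : N.IsMaximal) {a u : A} (ha : a ≠ 0)
    (hu : algebraMap A B u ∈ N) :
    ∃ k t b, algebraMap A B t ∉ N ∧ t * u ^ k = a * b := by
  obtain ⟨e, he⟩ := hB.exists_notMem_pow hN ((map_ne_zero_iff _ ho.injective).2 ha)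
  obtain ⟨s, hs, b, hb⟩ := hB.exists_dvd_mul hN
    (fun hmem => he (Ideal.pow_le_pow_right e.le_succ hmem)) (Ideal.pow_mem_pow hu e)
  obtain ⟨s₁, b₁, hs₁, hb₁⟩ := h.exists_mul_mem_range ho hN.isPrime b
  obtain ⟨s₂, b₂, hs₂, hb₂⟩ := h.exists_mul_mem_range ho hN.isPrime s
  refine ⟨e, s₁ * b₂, s₂ * b₁, ?_, ho.injective ?_⟩
  · rw [map_mul]
    exact hN.isPrime.mul_notMem hs₁ (hb₂ ▸ hN.isPrime.mul_notMem hs₂ hs)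
  · simp only [map_mul, map_pow, ← hb₁, ← hb₂]
    linear_combination algebraMap A B s₁ * algebraMap A B s₂ * hb

end HasInvRadFactorization

/-! ### Isolation from weak factorization. -/

/-- The maximal ideal `N` is isolated in the maximal spectrum by a finitely generated ideal. -/
def Ideal.IsIsolated {B : Type*} [CommRing B] (N : Ideal B) : Prop :=
  ∃ F : Ideal B, F.FG ∧ F ≤ N ∧ ∀ N' : Ideal B, N'.IsMaximal → F ≤ N' → N' = N

namespace HasInvRadFactorization

variable {A B : Type*} [CommRing A] [IsDomain A] [CommRing B] [IsDomain B] [Algebra A B]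

theorem isIsolated_of_fg_le (h : HasInvRadFactorization A) (ho : IsOverring A B)
    {N : Ideal B} (hN : N.IsMaximal) {E : Ideal A} (hE : E.FG)
    (hle : E ≤ N.comap (algebraMap A B))
    (hiso : ∀ N' : Ideal B, N'.IsMaximal → E ≤ N'.comap (algebraMap A B) →
      N.comap (algebraMap A B) ≤ N'.comap (algebraMap A B)) : N.IsIsolated :=
  ⟨E.map (algebraMap A B), hE.map _, Ideal.map_le_iff_le_comap.2 hle, fun N' hN' hle' =>
    (hN.eq_of_le hN'.ne_top (h.le_of_comap_le ho hN'.isPrime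
      (hiso N' hN' (Ideal.map_le_iff_le_comap.1 hle')))).symm⟩

/-- Weak factorization isolates the maximal ideals of the overring lying over nonmaximal primes. -/
theorem isIsolated_of_not_isMaximal_comap (h : HasInvRadFactorization A)
    (hWF : HasWeakFactorization A) (ho : IsOverring A B) (hB : IsAlmostDedekind B)
    {N : Ideal B} (hN : N.IsMaximal) (hmax : ¬ (N.comap (algebraMap A B)).IsMaximal) :
    N.IsIsolated := by
  by_contra hiso
  have hNp := hN.isPrime
  set P := N.comap (algebraMap A B) with hP
  have hPp : P.IsPrime := hNp.comap _
  obtain ⟨M, hM, hPM⟩ := Ideal.exists_le_maximal P hPp.ne_top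
  have hMP : ¬ M ≤ P := fun hle => hmax (le_antisymm hPM hle ▸ hM)
  obtain ⟨s, hsM, hsP⟩ := SetLike.not_le_iff_exists.1 hMP
  obtain ⟨p, hpP, hp0⟩ := Submodule.exists_mem_ne_zero_of_ne_bot (comap_ne_bot ho (hB.ne_bot N hN))
  have hs0 : s ≠ 0 := by rintro rfl; exact hsP (zero_mem _)
  have ha0 : s * p ≠ 0 := mul_ne_zero hs0 hp0
  -- The contraction of `s * p * A_M`. Its radical is `P`, but `p ∉ I` because `s ∈ M`.
  let I : Ideal A :=
    { carrier := {x | ∃ u ∉ M, s * p ∣ u * x}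
      add_mem' := by
        rintro x y ⟨u, hu, hux⟩ ⟨v, hv, hvy⟩
        refine ⟨u * v, hM.isPrime.mul_notMem hu hv, ?_⟩
        have : u * v * (x + y) = v * (u * x) + u * (v * y) := by ring
        rw [this]
        exact dvd_add (hux.mul_left _) (hvy.mul_left _)
      zero_mem' := ⟨1, hM.isPrime.one_notMem, by simp⟩
      smul_mem' := by
        rintro r x ⟨u, hu, hux⟩
        exact ⟨u, hu, by rw [smul_eq_mul, mul_left_comm]; exact hux.mul_left _⟩ }
  have hI : ∀ x, x ∈ I ↔ ∃ u ∉ M, s * p ∣ u * x := fun x => Iff.rfl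
  have haI : s * p ∈ I := ⟨1, hM.isPrime.one_notMem, by simp⟩
  have hI0 : I ≠ ⊥ := by
    intro hb
    rw [hb, Ideal.mem_bot] at haI
    exact ha0 haI
  have hIP : I ≤ P := by
    rintro x ⟨u, hu, hux⟩
    exact (hPp.mem_or_mem (P.mem_of_dvd hux (P.mul_mem_left _ hpP))).resolve_left
      fun h' => hu (hPM h')
  have hpI : p ∉ I := by
    rintro ⟨u, hu, c, hc⟩
    have : u = s * c := by
      apply mul_right_cancel₀ hp0
      linear_combination hc
    exact hu (this ▸ M.mul_mem_right _ hsM)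
  have hpow : ∀ u ∈ P, ∃ k, u ^ k ∈ I := by
    intro u hu
    obtain ⟨k, t, b, ht, htb⟩ := h.exists_mul_pow_eq ho hB hN ha0 hu
    obtain ⟨w, hw, d, hd, hwd⟩ := h.exists_mul_eq_mul_of_le hPp hM.isPrime hPM
      (x := b * u) (r := t) (P.mul_mem_left _ hu) ht
    refine ⟨k + 1, w, hw, d, ?_⟩
    have ht0 : t ≠ 0 := by rintro rfl; exact ht (by simp)
    apply mul_left_cancel₀ ht0
    linear_combination s * p * hwd + u * w * htb
  -- The finitely generated ideal `(c : b)` contains `I`, so inside `P` it would isolate `N`. An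
  -- element `e` of it outside `P` divides `x` locally above `P`; away from `P`, `I` is locally
  -- trivial.
  have hPhull : P ≤ I.divisorialHull := by
    intro x hx b c hc hbc
    have hE : ¬ Ideal.dvdColon c b ≤ P := by
      intro hle
      refine hiso (h.isIsolated_of_fg_le ho hN (h.dvdColon_fg hc b) hle fun N' hN' hle' => ?_)
      intro u hu
      obtain ⟨k, hk⟩ := hpow u hu
      exact (hN'.isPrime.comap (algebraMap A B)).mem_of_pow_mem k (hle' (hbc _ hk))
    obtain ⟨e, he, heP⟩ := SetLike.not_le_iff_exists.1 hE
    rw [← Ideal.mem_span_singleton]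
    refine Ideal.mem_of_forall_isMaximal fun M' hM' => ?_
    by_cases hPM' : P ≤ M'
    · obtain ⟨u, hu, d, hd, hud⟩ := h.exists_mul_eq_mul_of_le hPp hM'.isPrime hPM' hx heP
      refine ⟨u, hu, Ideal.mem_span_singleton.2 ?_⟩
      have : u * (b * x) = b * e * d := by linear_combination b * hud
      rw [this]
      exact Dvd.dvd.mul_right he d
    · obtain ⟨u, hu, huM'⟩ := SetLike.not_le_iff_exists.1 hPM'
      obtain ⟨k, hk⟩ := hpow u hu
      refine ⟨u ^ k, fun hmem => huM' (hM'.isPrime.mem_of_pow_mem k hmem),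
        Ideal.mem_span_singleton.2 ?_⟩
      have : u ^ k * (b * x) = b * u ^ k * x := by ring
      rw [this]
      exact (hbc _ hk).mul_right x
  obtain ⟨L, hL, hIL⟩ := hWF.eq_divisorialHull_mul hI0 fun heq => hpI (heq ▸ hPhull hpP)
  -- The maximal factors are not below the nonmaximal prime `P`, so `p` is divisible at `M` by an
  -- element `y` of their product; the quotient is in `P`, hence in the closure, which forces `p ∈
  -- I`.
  have hLP : ¬ L.prod ≤ P := by
    rw [hPp.multiset_prod_le]
    rintro ⟨m, hm, hle⟩
    exact hmax ((hL m hm).eq_of_le hPp.ne_top hle ▸ hL m hm)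
  obtain ⟨y, hyL, hyP⟩ := SetLike.not_le_iff_exists.1 hLP
  obtain ⟨u, hu, d, hd, hud⟩ := h.exists_mul_eq_mul_of_le hPp hM.isPrime hPM hpP hyP
  have hmem : p * u ∈ I := by
    rw [hud, hIL, mul_comm y d]
    exact Ideal.mul_mem_mul (hPhull hd) hyL
  obtain ⟨v, hv, hdv⟩ := hmem
  exact hpI ⟨v * u, hM.isPrime.mul_notMem hv hu, by
    have : v * u * p = v * (p * u) := by ring
    rwa [this]⟩

end HasInvRadFactorization

/-- Some `f ∉ N'` has `f * F ^ e` inside the intersection; if no `N i` contained `F`, all of them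
would contain `f`. Thus `N'` is a limit of the family. -/
theorem IsAlmostDedekind.exists_le_of_iInf_le {B : Type*} [CommRing B] [IsDomain B]
    (hB : IsAlmostDedekind B) {ι : Type*} {N : ι → Ideal B} (hN : ∀ i, (N i).IsMaximal)
    (h0 : ⨅ i, N i ≠ ⊥) {N' : Ideal B} (hN' : N'.IsMaximal) (hle : ⨅ i, N i ≤ N')
    {F : Ideal B} (hF : F.FG) (hFN' : F ≤ N') : ∃ i, F ≤ N i := by
  obtain ⟨e, -, he⟩ := hB.exists_order hN' h0
  obtain ⟨d, hdR, hd⟩ := SetLike.not_le_iff_exists.1 he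
  obtain ⟨f, hf, hfD⟩ := Ideal.exists_forall_mul_mem_of_fg hN'.isPrime (D := ⨅ i, N i)
    (hF.pow (n := e)) (by
      intro x hx
      obtain ⟨s, hs, hdvd⟩ := hB.exists_dvd_mul hN' hd (Ideal.pow_right_mono hFN' e hx)
      exact ⟨s, hs, Ideal.mem_of_dvd _ hdvd hdR⟩)
  by_contra! hc
  refine hf (hle ((Submodule.mem_iInf _).2 fun i => ?_))
  by_contra hfi
  refine hc i ((hN i).isPrime.le_of_pow_le (n := e) fun x hx => ?_)
  exact ((hN i).isPrime.mem_or_mem ((Submodule.mem_iInf _).1 (hfD x hx) i)).resolve_left hfi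

namespace HasInvRadFactorization

variable {A B : Type*} [CommRing A] [IsDomain A] [CommRing B] [IsDomain B] [Algebra A B]

/-- Weak factorization excludes infinite discrete families of nonisolated maximal ideals with
nonzero intersection. -/
theorem not_forall_separated (h : HasInvRadFactorization A)
    (hWF : HasWeakFactorization A) (ho : IsOverring A B) (hB : IsAlmostDedekind B)
    {N : ℕ → Ideal B} (hN : ∀ n, (N n).IsMaximal) (hiso : ∀ n, ¬ (N n).IsIsolated)
    (hinj : Function.Injective N) (h0 : ⨅ n, N n ≠ ⊥)
    (hsep : ∀ n, ∃ g ∉ N n, ∀ j ≠ n, g ∈ N j) : False := by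
  have hNp := fun n => (hN n).isPrime
  let P : ℕ → Ideal A := fun n => (N n).comap (algebraMap A B)
  have hPp : ∀ n, (P n).IsPrime := fun n => (hNp n).comap _
  have hPmax : ∀ n, (P n).IsMaximal := fun n => by
    by_contra hP
    exact hiso n (h.isIsolated_of_not_isMaximal_comap hWF ho hB (hN n) hP)
  have hsep' : ∀ n, ∃ g ∉ P n, ∀ j ≠ n, g ∈ P j := by
    intro n
    obtain ⟨g, hg, hgj⟩ := hsep n
    obtain ⟨s, x, hs, hsx⟩ := h.exists_mul_mem_range ho (hNp n) g
    refine ⟨x, fun hx => ?_, fun j hj => ?_⟩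
    · exact (hNp n).mul_notMem hs hg (hsx ▸ hx)
    · change algebraMap A B x ∈ N j
      exact hsx ▸ (N j).mul_mem_left _ (hgj j hj)
  set R : Ideal A := (⨅ n, N n).comap (algebraMap A B) with hR
  have hmemR : ∀ x, x ∈ R ↔ ∀ n, x ∈ P n := fun x => by
    rw [hR, Ideal.mem_comap, Submodule.mem_iInf]; rfl
  -- If `(c : b) ≤ P n`, then `P n = (c : b g)` is finitely generated and `N n` isolated. A maximal
  -- ideal over `(c : b)` contains the contraction of some `N'` in the limit of the family: if that
  -- contraction is maximal, some `P n` contains `(c : b)`; if not, `N'` is isolated and so is one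
  -- of the `N n`, whose contractions are maximal.
  have hhull : R.divisorialHull = ⊤ := by
    rw [Ideal.eq_top_iff_one]
    intro b c hc hbc
    have hEfg := h.dvdColon_fg hc b
    have hRE : R ≤ Ideal.dvdColon c b := fun r hr => hbc r hr
    have hEP : ∀ n, ¬ Ideal.dvdColon c b ≤ P n := by
      intro n hle
      obtain ⟨g, hg, hgj⟩ := hsep' n
      have hle' : P n ≤ Ideal.dvdColon c (b * g) := by
        intro x hx
        rw [Ideal.mem_dvdColon, mul_assoc]
        refine hbc _ ((hmemR _).2 fun j => ?_)
        by_cases hj : j = n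
        · subst hj; exact (P j).mul_mem_left _ hx
        · exact (P j).mul_mem_right _ (hgj j hj)
      by_cases ht : Ideal.dvdColon c (b * g) = ⊤
      · have h1 := (Ideal.eq_top_iff_one _).1 ht
        rw [Ideal.mem_dvdColon, mul_one] at h1
        exact hg (hle h1)
      · have heq := (hPmax n).eq_of_le ht hle'
        exact hiso n (h.isIsolated_of_fg_le ho (hN n) (heq ▸ h.dvdColon_fg hc (b * g) :
          (P n).FG) le_rfl fun N' _ hle => hle)
    have htop : Ideal.dvdColon c b = ⊤ := by
      by_contra hne
      obtain ⟨Q, hQ, hEQ⟩ := Ideal.exists_le_maximal _ hne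
      obtain ⟨Q', hQ', hQQ'⟩ := Ideal.exists_minimalPrimes_le (hRE.trans hEQ)
      obtain ⟨N', hN'p, hRN', rfl⟩ := Ideal.exists_comap_eq_of_mem_minimalPrimes _ _ hQ'
      have hN' := hB.isMaximal N' hN'p fun hb => h0 (le_bot_iff.1 (hb ▸ hRN'))
      by_cases hmax : (N'.comap (algebraMap A B)).IsMaximal
      · rw [← hmax.eq_of_le hQ.ne_top hQQ'] at hEQ
        obtain ⟨n, hn⟩ := hB.exists_le_of_iInf_le hN h0 hN' hRN' (hEfg.map (algebraMap A B))
          (Ideal.map_le_iff_le_comap.2 hEQ)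
        exact hEP n (Ideal.map_le_iff_le_comap.1 hn)
      · obtain ⟨F, hF, hFN', hFiso⟩ := h.isIsolated_of_not_isMaximal_comap hWF ho hB hN' hmax
        obtain ⟨n, hn⟩ := hB.exists_le_of_iInf_le hN h0 hN' hRN' hF hFN'
        exact hmax (hFiso (N n) (hN n) hn ▸ hPmax n)
    exact Ideal.mem_dvdColon.1 ((Ideal.eq_top_iff_one _).1 htop)
  have hRP : ∀ n, R ≤ P n := fun n x hx => (hmemR x).1 hx n
  -- Now `R` is a finite product of maximal ideals, although it lies in infinitely many `P n`.
  obtain ⟨L, hL, hRL⟩ := hWF.eq_divisorialHull_mul (comap_ne_bot ho h0) (by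
    rw [hhull]
    exact fun ht => (hPp 0).ne_top (top_le_iff.1 (ht ▸ hRP 0)))
  rw [hhull, Ideal.top_mul] at hRL
  have hPL : ∀ n, P n ∈ L := by
    intro n
    obtain ⟨m, hm, hle⟩ := (hPp n).multiset_prod_le.1 (hRL.ge.trans (hRP n))
    exact (hL m hm).eq_of_le (hPp n).ne_top hle ▸ hm
  have hPinj : Function.Injective P := fun i j hij => hinj
    (le_antisymm (h.le_of_comap_le ho (hNp j) hij.le) (h.le_of_comap_le ho (hNp i) hij.ge))
  classical
  exact Set.infinite_range_of_injective hPinj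
    (L.toFinset.finite_toSet.subset (by rintro _ ⟨n, rfl⟩; simpa using hPL n))

/-- Maximal ideals containing `a` form a Hausdorff space: if `a ∣ s * x ^ e`, the basic opens of `s`
and `x` are disjoint there. An infinite Hausdorff space has an infinite discrete subspace, which
`not_forall_separated` forbids. -/
theorem finite_not_isIsolated (h : HasInvRadFactorization A)
    (hWF : HasWeakFactorization A) (ho : IsOverring A B) (hB : IsAlmostDedekind B)
    {a : B} (ha : a ≠ 0) :
    {N : Ideal B | N.IsMaximal ∧ a ∈ N ∧ ¬ N.IsIsolated}.Finite := by
  by_contra hinf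
  let X := {N : PrimeSpectrum B // N.asIdeal.IsMaximal ∧ a ∈ N.asIdeal ∧ ¬ N.asIdeal.IsIsolated}
  have hX : Infinite X := by
    rw [← not_finite_iff_infinite]
    intro hfin
    refine hinf ((Set.finite_range fun N : X => N.1.asIdeal).subset ?_)
    rintro N hN
    exact ⟨⟨⟨N, hN.1.isPrime⟩, hN⟩, rfl⟩
  have hT2 : T2Space X := by
    refine ⟨fun N N' hne => ?_⟩
    have hle : ¬ N.1.asIdeal ≤ N'.1.asIdeal := fun hle =>
      hne (Subtype.ext (PrimeSpectrum.ext (N.2.1.eq_of_le N'.2.1.ne_top hle)))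
    obtain ⟨x, hx, hx'⟩ := SetLike.not_le_iff_exists.1 hle
    obtain ⟨e, he⟩ := hB.exists_notMem_pow N.2.1 ha
    obtain ⟨s, hs, hdvd⟩ := hB.exists_dvd_mul N.2.1
      (fun hmem => he (Ideal.pow_le_pow_right e.le_succ hmem)) (Ideal.pow_mem_pow hx e)
    refine ⟨Subtype.val ⁻¹' (PrimeSpectrum.basicOpen s : Set (PrimeSpectrum B)),
      Subtype.val ⁻¹' (PrimeSpectrum.basicOpen x : Set (PrimeSpectrum B)),
      (PrimeSpectrum.basicOpen s).isOpen.preimage continuous_subtype_val,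
      (PrimeSpectrum.basicOpen x).isOpen.preimage continuous_subtype_val, hs, hx', ?_⟩
    rw [Set.disjoint_left]
    intro M hMs hMx
    have hM := M.2.1.isPrime
    rcases hM.mem_or_mem (M.1.asIdeal.mem_of_dvd hdvd M.2.2.1) with h1 | h1
    · exact hMs h1
    · exact hMx (hM.mem_of_pow_mem e h1)
  obtain ⟨f, hf⟩ := exists_topology_isEmbedding_nat X
  refine h.not_forall_separated hWF ho hB (N := fun n => (f n).1.asIdeal) (fun n => (f n).2.1)
    (fun n => (f n).2.2.2) (fun i j hij => hf.injective (Subtype.ext (PrimeSpectrum.ext hij))) ?_ ?_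
  · intro hb
    have : a ∈ ⨅ n, (f n).1.asIdeal := (Submodule.mem_iInf _).2 fun n => (f n).2.2.1
    rw [hb, Ideal.mem_bot] at this
    exact ha this
  · intro n
    obtain ⟨U, hU, hUn⟩ := hf.isInducing.isOpen_iff.1 (isOpen_discrete {n})
    obtain ⟨V, hV, rfl⟩ := isOpen_induced_iff.1 hU
    obtain ⟨S, hS⟩ := (PrimeSpectrum.isOpen_iff V).1 hV
    have hmem : ∀ j, (f j).1 ∈ V ↔ j = n := fun j => by
      rw [← Set.mem_singleton_iff, ← hUn]; rfl
    have hmem' : ∀ j, (f j).1 ∈ V ↔ ¬ S ⊆ (f j).1.asIdeal := fun j => by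
      rw [← not_not (a := (f j).1 ∈ V), ← Set.mem_compl_iff, hS, PrimeSpectrum.mem_zeroLocus]
    obtain ⟨g, hgS, hg⟩ := Set.not_subset.1 ((hmem' n).1 ((hmem n).2 rfl))
    refine ⟨g, hg, fun j hj => ?_⟩
    by_contra hgj
    exact hj ((hmem j).1 ((hmem' j).2 fun hsub => hgj (hsub hgS)))

end HasInvRadFactorization

/-! ### Excluding critical maximal ideals. -/

theorem Set.Infinite.exists_subset_infinite_diff {α : Type*} {T : Set α} (hT : T.Infinite) :
    ∃ S ⊆ T, S.Infinite ∧ (T \ S).Infinite := by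
  have := hT.to_subtype
  let f : ℕ ↪ T := _root_.Infinite.natEmbedding T
  refine ⟨Set.range fun n => (f (2 * n) : α), ?_, ?_, ?_⟩
  · rintro _ ⟨n, rfl⟩
    exact (f _).2
  · refine Set.infinite_range_of_injective fun i j hij => ?_
    have := f.injective (Subtype.ext hij)
    omega
  · refine (Set.infinite_range_of_injective (f := fun n => (f (2 * n + 1) : α))
      fun i j hij => ?_).mono ?_
    · have := f.injective (Subtype.ext hij)
      omega
    · rintro _ ⟨n, rfl⟩
      refine ⟨(f _).2, ?_⟩
      rintro ⟨m, hm⟩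
      have := f.injective (Subtype.ext hm)
      omega

theorem Ideal.exists_fg_forall_not_le {B : Type*} [CommRing B] {N : Ideal B} (hN : N.IsMaximal)
    {T : Set (Ideal B)} (hT : T.Finite) (hTmax : ∀ N' ∈ T, N'.IsMaximal ∧ N' ≠ N)
    {E : Ideal B} (hE : E.FG) (hEN : E ≤ N) :
    ∃ E' : Ideal B, E'.FG ∧ E ≤ E' ∧ E' ≤ N ∧ ∀ N' ∈ T, ¬ E' ≤ N' := by
  have hb : ∀ N' ∈ T, ∃ b ∈ N, b ∉ N' := fun N' hN' =>
    SetLike.not_le_iff_exists.1 fun hle =>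
      (hTmax N' hN').2 (hN.eq_of_le (hTmax N' hN').1.ne_top hle).symm
  choose! b hbN hbN' using hb
  refine ⟨E ⊔ Ideal.span (b '' T), Submodule.FG.sup hE (Submodule.fg_span (hT.image b)),
    le_sup_left, sup_le hEN (Ideal.span_le.2 ?_), fun N' hN' hle => ?_⟩
  · rintro _ ⟨N', hN', rfl⟩
    exact hbN N' hN'
  · exact hbN' N' hN' (hle (Ideal.mem_sup_right (Ideal.subset_span ⟨N', hN', rfl⟩)))

namespace IsAlmostDedekind

variable {B : Type*} [CommRing B] [IsDomain B]

/-- Adding to `F` an element of order one at `N` gives `N`, by comparing orders. -/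
theorem fg_of_isIsolated (hB : IsAlmostDedekind B) {N : Ideal B} (hN : N.IsMaximal)
    (hiso : N.IsIsolated) : N.FG := by
  obtain ⟨F, hF, hFN, hFiso⟩ := hiso
  obtain ⟨π, hπN, hπ2⟩ := hB.exists_notMem_sq hN
  have : N = F ⊔ Ideal.span {π} := by
    refine le_antisymm (hB.le_of_forall_order fun N' hN' => ?_)
      (sup_le hFN ((Ideal.span_singleton_le_iff_mem _).2 hπN))
    by_cases hNN' : N' = N
    · subst hNN'
      refine ⟨1, by rw [pow_one], fun hle => hπ2 ?_⟩
      exact hle (Ideal.mem_sup_right (Ideal.mem_span_singleton_self π))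
    · refine ⟨0, by simp, fun hle => hNN' (hFiso N' hN' ?_)⟩
      rw [zero_add, pow_one] at hle
      exact le_sup_left.trans hle
  rw [this]
  exact Submodule.FG.sup hF (Submodule.fg_span_singleton π)

/-- A local multiple of `π ^ e` serves as `z`. Adjoining it lowers the order at one isolated maximal
ideal without changing the others. -/
theorem exists_notMem_colon (hB : IsAlmostDedekind B) {N : Ideal B} (hN : N.IsMaximal)
    (hiso : N.IsIsolated) {E : Ideal B} {e : ℕ} (hE : ¬ E ≤ N ^ (e + 2)) :
    ∃ z ∉ N ^ (e + 1), ∀ x ∈ N, z * x ∈ E := by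
  have hfg := hB.fg_of_isIsolated hN hiso
  obtain ⟨π, hπN, hπ2⟩ := hB.exists_notMem_sq hN
  have hz : π ^ e ∉ N ^ (e + 1) := by
    have := hB.not_pow_le_pow hN (E := Ideal.span {π})
      (by rwa [Ideal.span_singleton_le_iff_mem]) e
    rwa [Ideal.span_singleton_pow, Ideal.span_singleton_le_iff_mem] at this
  obtain ⟨d, hdE, hd⟩ := SetLike.not_le_iff_exists.1 hE
  obtain ⟨f, hf, hfE⟩ := Ideal.exists_forall_mul_mem_of_fg hN.isPrime (D := E)
    (F := Ideal.span {π ^ e} * N) ((Submodule.fg_span_singleton _).mul hfg) (by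
      intro x hx
      have hx' : x ∈ N ^ (e + 1) := by
        rw [pow_succ]
        exact Ideal.mul_mono_left ((Ideal.span_singleton_le_iff_mem _).2
          (Ideal.pow_mem_pow hπN e)) hx
      obtain ⟨s, hs, hdvd⟩ := hB.exists_dvd_mul hN hd hx'
      exact ⟨s, hs, E.mem_of_dvd hdvd hdE⟩)
  refine ⟨f * π ^ e, fun hmem => hz (mem_pow_of_mul_mem hN hf hmem), fun x hx => ?_⟩
  rw [mul_assoc]
  exact hfE _ (Ideal.mul_mem_mul (Ideal.mem_span_singleton_self _) hx)

/-- A maximal ideal having a finitely generated subideal, all of whose other maximal overideals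
are isolated, is not critical. -/
theorem exists_noncritical (hB : IsAlmostDedekind B)
    (hfac : ∀ C : Ideal B, C ≠ ⊥ → ∃ (J : Ideal B) (Q : Multiset (Ideal B)),
      J.FG ∧ (∀ q ∈ Q, q.IsRadical) ∧ C = J * Q.prod)
    {N : Ideal B} (hN : N.IsMaximal) {E : Ideal B} (hE : E.FG) (hEN : E ≤ N) (hE2 : ¬ E ≤ N ^ 2)
    (hiso : ∀ N' : Ideal B, N'.IsMaximal → E ≤ N' → N' ≠ N → N'.IsIsolated) :
    ∃ E : Ideal B, E.FG ∧ E ≤ N ∧ ∀ N' : Ideal B, N'.IsMaximal → ¬ E ≤ N' ^ 2 := by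
  by_contra! hcrit
  have hE0 : E ≠ ⊥ := by rintro rfl; exact hE2 bot_le
  let T : Set (Ideal B) := {N' | N'.IsMaximal ∧ E ≤ N' ^ 2}
  have hTN : ∀ N' ∈ T, N' ≠ N := by
    rintro _ hN' rfl
    exact hE2 hN'.2
  have hTE : ∀ N' ∈ T, E ≤ N' := fun N' hN' => hN'.2.trans (Ideal.pow_le_self two_ne_zero)
  -- Otherwise finitely many added generators would move `E` out of every member of `T`, against
  -- criticality.
  have hTinf : T.Infinite := by
    intro hTfin
    obtain ⟨E', hE', hEE', hEN', hE'T⟩ := Ideal.exists_fg_forall_not_le hN hTfin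
      (fun N' hN' => ⟨hN'.1, hTN N' hN'⟩) hE hEN
    obtain ⟨N', hN', hle⟩ := hcrit E' hE' hEN'
    exact hE'T N' ⟨hN', hEE'.trans hle⟩ (hle.trans (Ideal.pow_le_self two_ne_zero))
  have hfin : ∀ r ∉ N, {N' : Ideal B | N' ∈ T ∧ r ∈ N'}.Finite := by
    intro r hr
    refine (hB.finite_of_forall_isolated (E := E ⊔ Ideal.span {r})
      (fun hb => hE0 (le_bot_iff.1 (hb ▸ le_sup_left))) fun N' hN' hle => ?_).subset ?_
    · refine hiso N' hN' (le_sup_left.trans hle) ?_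
      rintro rfl
      exact hr (hle (Ideal.mem_sup_right (Ideal.mem_span_singleton_self r)))
    · rintro N' ⟨hN', hrN'⟩
      exact ⟨hN'.1, sup_le (hTE N' hN') ((Ideal.span_singleton_le_iff_mem _).2 hrN')⟩
  obtain ⟨S, hST, hSinf, hTSinf⟩ := hTinf.exists_subset_infinite_diff
  -- Compared with `E`, the ideal `I` has smaller order at each member of `S` and the same order at
  -- all other maximal ideals.
  let U : Set B := {z | ∃ n ∈ S, ∀ x ∈ n, z * x ∈ E}
  let I : Ideal B := E ⊔ Ideal.span U
  have hEI : E ≤ I := le_sup_left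
  have hI0 : I ≠ ⊥ := fun hb => hE0 (le_bot_iff.1 (hb ▸ hEI))
  have hIle : ∀ N' : Ideal B, N'.IsMaximal → N' ∉ S → ∀ k, E ≤ N' ^ k → I ≤ N' ^ k := by
    intro N' hN' hS k hk
    refine sup_le hk (Ideal.span_le.2 ?_)
    rintro z ⟨n, hn, hz⟩
    have hnN' : ¬ n ≤ N' := fun hle => hS ((hST hn).1.eq_of_le hN'.ne_top hle ▸ hn)
    obtain ⟨x, hx, hx'⟩ := SetLike.not_le_iff_exists.1 hnN'
    exact mem_pow_of_mul_mem hN' hx' (mul_comm z x ▸ hk (hz x hx))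
  have hIS : ∀ n ∈ S, ∃ e, E ≤ n ^ e ∧ ¬ I ≤ n ^ e := by
    intro n hn
    have hnT := hST hn
    obtain ⟨e, he, he'⟩ := hB.exists_order hnT.1 hE0
    have h2 : 2 ≤ e := by
      by_contra! hlt
      exact he' (hnT.2.trans (Ideal.pow_le_pow_right (by omega)))
    obtain ⟨k, rfl⟩ := Nat.exists_eq_add_of_le h2
    obtain ⟨z, hz, hzE⟩ := hB.exists_notMem_colon hnT.1 (e := k + 1)
      (hiso n hnT.1 (hTE n hnT) (hTN n hnT)) (E := E) (by
        rwa [show k + 1 + 2 = 2 + k + 1 by omega])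
    refine ⟨2 + k, he, fun hle => hz ?_⟩
    rw [show k + 1 + 1 = 2 + k by omega]
    exact hle (Ideal.mem_sup_right (Ideal.subset_span ⟨n, hn, hzE⟩))
  have hNS : N ∉ S := fun hS => hTN N (hST hS) rfl
  have hIN : I ≤ N := by simpa using hIle N hN hNS 1 (by simpa using hEN)
  have hIN2 : ¬ I ≤ N ^ 2 := fun hle => hE2 (hEI.trans hle)
  obtain ⟨J, Q, hJ, hQ, hIJ⟩ := hfac I hI0
  by_cases hq : ∃ q ∈ Q, q ≤ N
  · obtain ⟨q, hqQ, hqN⟩ := hq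
    obtain ⟨Q, rfl⟩ := Multiset.exists_cons_of_mem hqQ
    rw [Multiset.prod_cons, mul_left_comm] at hIJ
    have hq0 : q ≠ ⊥ := by
      rintro rfl
      rw [Ideal.bot_mul] at hIJ
      exact hI0 hIJ
    -- Since `I` has order one at `N`, the cofactor of `q` has an element `r ∉ N`. At members of `T
    -- \ S` avoiding `r`, the order of `I` would be at most one, so only finitely many remain.
    have hR : ¬ J * Q.prod ≤ N := fun hle => hIN2 (by
      rw [hIJ, sq]
      exact Ideal.mul_mono hqN hle)
    obtain ⟨r, hr, hrN⟩ := SetLike.not_le_iff_exists.1 hR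
    refine hTSinf ((hfin r hrN).subset ?_)
    rintro n ⟨hnT, hnS⟩
    refine ⟨hnT, ?_⟩
    by_contra hrn
    refine hB.not_mul_le_pow hnT.1 (e := 1) (f := 0) ((hQ q hqQ).not_le_sq hB hnT.1 hq0)
      (by rw [zero_add, pow_one]; exact fun hle => hrn (hle hr)) ?_
    rw [← hIJ]
    exact hIle n hnT.1 hnS 2 hnT.2
  · have hJN : J ≤ N := by
      rcases hN.isPrime.mul_le.1 (hIJ ▸ hIN) with h1 | h1
      · exact h1
      · exact absurd (hN.isPrime.multiset_prod_le.1 h1) hq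
    -- Here `g * J ≤ E` for some `g ∉ N`. At members of `S` avoiding `g`, the order of `I ≤ J` would
    -- not have dropped, so `S` would be finite.
    obtain ⟨d, hdE, hd⟩ := SetLike.not_le_iff_exists.1 hE2
    obtain ⟨g, hg, hgE⟩ := Ideal.exists_forall_mul_mem_of_fg hN.isPrime (D := E) hJ (by
      intro x hx
      obtain ⟨s, hs, hdvd⟩ := hB.exists_dvd_mul hN (e := 1) hd (by simpa using hJN hx)
      exact ⟨s, hs, E.mem_of_dvd hdvd hdE⟩)
    refine hSinf ((hfin g hg).subset fun n hn => ⟨hST hn, ?_⟩)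
    by_contra hgn
    obtain ⟨e, he, he'⟩ := hIS n hn
    refine he' (hIJ ▸ Ideal.mul_le_left.trans fun x hx => ?_)
    exact mem_pow_of_mul_mem (hST hn).1 hgn (he (hgE x hx))

end IsAlmostDedekind

/-! ### Conclusion. -/

theorem HasInvRadFactorization.isSPDomain_of_isOverring {A B : Type*} [CommRing A] [IsDomain A]
    [CommRing B] [IsDomain B] [Algebra A B] (h : HasInvRadFactorization A)
    (hWF : HasWeakFactorization A) (ho : IsOverring A B) (hB : IsAlmostDedekind B) :
    IsSPDomain B := by
  refine hB.isSPDomain fun N hN => ?_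
  obtain ⟨a, haN, ha2⟩ := hB.exists_notMem_sq hN
  have ha0 : a ≠ 0 := by rintro rfl; exact ha2 (zero_mem _)
  -- Enlarging `(a)` inside `N` removes the finitely many other nonisolated maximal ideals;
  -- containing `a`, `E` still has order one at `N`.
  obtain ⟨E, hE, haE, hEN, hEbad⟩ := Ideal.exists_fg_forall_not_le hN
    ((h.finite_not_isIsolated hWF ho hB ha0).subset (Set.sdiff_subset (t := {N})))
    (fun N' hN' => ⟨hN'.1.1, hN'.2⟩) (Submodule.fg_span_singleton a)
    ((Ideal.span_singleton_le_iff_mem _).2 haN)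
  rw [Ideal.submodule_span_eq, Ideal.span_singleton_le_iff_mem] at haE
  refine hB.exists_noncritical (fun C hC => h.exists_eq_mul_prod ho hC) hN hE hEN
    (fun hle => ha2 (hle haE)) fun N' hN' hle hne => ?_
  by_contra hiso
  exact hEbad N' ⟨⟨hN', hle haE, hiso⟩, hne⟩ hle

theorem Subalgebra.isOverring {A K : Type*} [CommRing A] [IsDomain A] [Field K] [Algebra A K]
    [IsFractionRing A K] (B : Subalgebra A K) : IsOverring A B where
  injective := fun x y hxy => IsFractionRing.injective A K (congrArg Subtype.val hxy)
  exists_mul_eq := by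
    intro b
    obtain ⟨x, y, hy, hxy⟩ := IsFractionRing.div_surjective (A := A) (b : K)
    have hy' : algebraMap A K y ≠ 0 := by simpa using nonZeroDivisors.ne_zero hy
    refine ⟨x, y, nonZeroDivisors.ne_zero hy, Subtype.ext ?_⟩
    change algebraMap A K y * (b : K) = algebraMap A K x
    rw [← hxy, mul_div_cancel₀ _ hy']

theorem corollary3p5 {A : Type*} [CommRing A] [IsDomain A]
    {K : Type*} [Field K] [Algebra A K] [IsFractionRing A K]
    (hISP : IsISPDomain A) (hWF : HasWeakFactorization A)
    (B : Subalgebra A K) (hB : ringKrullDim B = 1) :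
    IsSPDomain B := by
  have h := hISP.hasInvRadFactorization
  have hle : Ring.KrullDimLE 1 B := Ring.krullDimLE_iff.2 hB.le
  refine h.isSPDomain_of_isOverring hWF B.isOverring (h.isAlmostDedekind B.isOverring
    (fun P hP hP0 => hP.isMaximal_of_ne_bot hP0) fun hf => ?_)
  rw [ringKrullDim_eq_zero_of_isField hf] at hB
  exact zero_ne_one hB
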